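/- Let $0\le k\le n$ be integers. Let $J_{2m}=\begin{bmatrix}0&I_m\\-I_m&0\end{bmatrix}$ and $\omega_0(x,y)=x^TJ_{2n}y$ on $\mathbb R^{2n}$; for $A\in\mathbb R^{2n\times 2k}$ let $A^+=J_{2k}^TA^TJ_{2n}$. For a subspace $W\subseteq\mathbb R^{2n}$ let $W^\perp=\{v:\omega_0(v,u)=0\ \forall u\in W\}$; $W$ is symplectic if $W\cap W^\perp=\{0\}$, and the symplectic projection onto $W$ is the linear projection with range $W$ and kernel $W^\perp$. Put $$\mathrm{Sp}(2n,\mathbb R)=\{M\in\mathbb R^{2n\times2n}: M^+M=I_{2n}\},\qquad \mathrm{SpSt}(2n,2k)=\{U\in\mathbb R^{2n\times 2k}: U^+U=I_{2k}\},$$ $$\mathrm{SpGr}(2n,2k)=\{P\in\mathbb R^{2n\times 2n}: P^2=P,\ \operatorname{rank}P=2k,\ P^+=P\}.$$ 1. $\mathrm{SpGr}(2n,2k)$ consists exactly of the symplectic projections onto the $2k$-dimensional symplectic subspaces of $(\mathbb R^{2n},\omega_0)$, and every $2k$-dimensional symplectic subspace has exactly one symplectic projection onto it. 2. Every $P\in\mathrm{SpGr}(2n,2k)$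 equals $UU^+$ for some $U\in\mathrm{SpSt}(2n,2k)$. 3. $\mathrm{SpGr}(2n,2k)$, with the subspace topology of $\mathbb R^{2n\times2n}$, has a smooth manifold structure of dimension $4(n-k)k$ for which the inclusion into $\mathbb R^{2n\times 2n}$ is a smooth embedding, and it is diffeomorphic to $\mathrm{Sp}(2n,\mathbb R)/(\mathrm{Sp}(2k,\mathbb R)\times\mathrm{Sp}(2(n-k),\mathbb R))$. Here $\mathrm{Sp}(2n,\mathbb R)$ is a Lie group of dimension $(2n+1)n$ smoothly embedded in $\mathbb R^{2n\times 2n}$; $\mathrm{Sp}(2k,\mathbb R)\times\mathrm{Sp}(2(n-k),\mathbb R)$ is its subgroup of all matrices $$\begin{bmatrix}A_1&0&B_1&0\\0&A_2&0&B_2\\C_1&0&D_1&0\\0&C_2&0&D_2\end{bmatrix},\qquad \begin{bmatrix}A_1&B_1\\C_1&D_1\end{bmatrix}\in\mathrm{Sp}(2k,\mathbb R),\quad \begin{bmatrix}A_2&B_2\\C_2&D_2\end{bmatrix}\in\mathrm{Sp}(2(n-k),\mathbb R);$$ and the space of left cosets carries the quotient topology and a smooth manifold structure for which the quotient map is a surjective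 smooth submersion. The class of $M$ corresponds under the diffeomorphism to $M\,EE^+M^+$, where $E=\begin{bmatrix}I_{n,k}&0\\0&I_{n,k}\end{bmatrix}$ and $I_{n,k}=\begin{bmatrix}I_k\\0\end{bmatrix}\in\mathbb R^{n\times k}$. -/

import Mathlib

open Matrix
open scoped Manifold ContDiff

noncomputable section

namespace SpGrassmann

/-- Real matrices of size `2n × 2k`, rows and columns being split into two halves. -/
abbrev Mat (n k : ℕ) : Type := Matrix (Fin n ⊕ Fin n) (Fin k ⊕ Fin k) ℝ

/-- The matrix `J₂ₙ = [0, Iₙ; -Iₙ, 0]` (the negative of Mathlib's `Matrix.J`). -/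
def stdJ (n : ℕ) : Mat n n := Matrix.fromBlocks 0 1 (-1) 0

/-- The standard symplectic form `ω₀(x, y) = xᵀ J₂ₙ y` on `ℝ²ⁿ`. -/
def omega (n : ℕ) : LinearMap.BilinForm ℝ (Fin n ⊕ Fin n → ℝ) := Matrix.toBilin' (stdJ n)

/-- The symplectic complement of a subspace: all `v` with `ω₀(v, u) = 0` for every `u ∈ W`. -/
def sympCompl {n : ℕ} (W : Submodule ℝ (Fin n ⊕ Fin n → ℝ)) :
    Submodule ℝ (Fin n ⊕ Fin n → ℝ) where
  carrier := {v | ∀ u ∈ W, omega n v u = 0}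
  add_mem' ha hb u hu := by simp [ha u hu, hb u hu]
  zero_mem' u _ := by simp
  smul_mem' c v hv u hu := by simp [hv u hu]

/-- A subspace is symplectic if it meets its symplectic complement only in `0`. -/
def IsSymplecticSubspace {n : ℕ} (W : Submodule ℝ (Fin n ⊕ Fin n → ℝ)) : Prop :=
  sympCompl W ⊓ W = ⊥

/-- `P` is (the matrix of) the symplectic projection onto `W`: the linear projection onto `W`
along the symplectic complement of `W`. -/
structure IsSymplecticProjection {n : ℕ} (W : Submodule ℝ (Fin n ⊕ Fin n → ℝ))
    (P : Mat n n) : Prop where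
  idem : P * P = P
  range_eq : LinearMap.range P.mulVecLin = W
  ker_eq : LinearMap.ker P.mulVecLin = sympCompl W

/-- The symplectic inverse `A⁺ = J₂ₖᵀ Aᵀ J₂ₙ` of a `2n × 2k` matrix. -/
def sympInv {n k : ℕ} (A : Mat n k) : Mat k n := (stdJ k)ᵀ * Aᵀ * stdJ n

/-- The real symplectic Stiefel set: all `U ∈ ℝ^{2n × 2k}` with `U⁺ U = I`. -/
def SpSt (n k : ℕ) : Set (Mat n k) := {U | sympInv U * U = 1}

/-- The real symplectic Grassmannian: all `P ∈ ℝ^{2n × 2n}` with `P² = P`, `rank P = 2k`,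
`P⁺ = P`. -/
def SpGr (n k : ℕ) : Set (Mat n n) := {P | P ^ 2 = P ∧ P.rank = 2 * k ∧ sympInv P = P}

/-- The real symplectic group `Sp(2n, ℝ)`. -/
abbrev Sp (n : ℕ) : Type := Matrix.symplecticGroup (Fin n) ℝ

/-- Mathlib's symplectic group consists of the `M` with `M⁺ M = I`. -/
theorem mem_symplecticGroup_iff {n : ℕ} (M : Mat n n) :
    M ∈ Matrix.symplecticGroup (Fin n) ℝ ↔ sympInv M * M = 1 := by
  have hJ : stdJ n = -Matrix.J (Fin n) ℝ := by
    simp [stdJ, Matrix.J, Matrix.fromBlocks_neg]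
  rw [SymplecticGroup.mem_iff', sympInv, hJ]
  constructor
  · intro h
    have : (-Matrix.J (Fin n) ℝ)ᵀ * Mᵀ * -Matrix.J (Fin n) ℝ * M
        = -(Matrix.J (Fin n) ℝ * (Mᵀ * Matrix.J (Fin n) ℝ * M)) := by
      simp [Matrix.mul_assoc]
    rw [this, h, Matrix.J_squared, neg_neg]
  · intro h
    have : Mᵀ * Matrix.J (Fin n) ℝ * M = Matrix.J (Fin n) ℝ *
        ((-Matrix.J (Fin n) ℝ)ᵀ * Mᵀ * -Matrix.J (Fin n) ℝ * M) := by
      have h2 : ∀ X : Mat n n, Matrix.J (Fin n) ℝ * (Matrix.J (Fin n) ℝ * X) = -X := by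
        intro X
        rw [← Matrix.mul_assoc, Matrix.J_squared, Matrix.neg_mul, Matrix.one_mul]
      simp [Matrix.mul_assoc, h2]
    rw [this, h, Matrix.mul_one]

/-- The matrix `I_{n,k}`: the first `k` columns of `Iₙ`. -/
def inclMat (n k : ℕ) : Matrix (Fin n) (Fin k) ℝ := Matrix.of fun i j => if i.val = j.val then 1 else 0

/-- The matrix `E = [I_{n,k}, 0; 0, I_{n,k}]`. -/
def stdE (n k : ℕ) : Mat n k := Matrix.fromBlocks (inclMat n k) 0 0 (inclMat n k)

/-- The base point `E₀ = E E⁺`. -/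
def E₀ (n k : ℕ) : Mat n n := stdE n k * sympInv (stdE n k)

/-- `{1, …, n}` split into its first `k` and its last `n - k` elements. -/
def split {n k : ℕ} (hk : k ≤ n) : Fin k ⊕ Fin (n - k) ≃ Fin n :=
  finSumFinEquiv.trans (finCongr (Nat.add_sub_of_le hk))

/-- The `n × n` block diagonal matrix `diag(A₁, A₂)`. -/
def diag₂ {n k : ℕ} (hk : k ≤ n) (A₁ : Matrix (Fin k) (Fin k) ℝ)
    (A₂ : Matrix (Fin (n - k)) (Fin (n - k)) ℝ) : Matrix (Fin n) (Fin n) ℝ :=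
  Matrix.reindex (split hk) (split hk) (Matrix.fromBlocks A₁ 0 0 A₂)

/-- From `[A₁, B₁; C₁, D₁]` and `[A₂, B₂; C₂, D₂]`, the `2n × 2n` matrix
`[A₁, 0, B₁, 0; 0, A₂, 0, B₂; C₁, 0, D₁, 0; 0, C₂, 0, D₂]`. -/
def blockMat {n k : ℕ} (hk : k ≤ n) (M₁ : Mat k k) (M₂ : Mat (n - k) (n - k)) : Mat n n :=
  Matrix.fromBlocks
    (diag₂ hk M₁.toBlocks₁₁ M₂.toBlocks₁₁) (diag₂ hk M₁.toBlocks₁₂ M₂.toBlocks₁₂)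
    (diag₂ hk M₁.toBlocks₂₁ M₂.toBlocks₂₁) (diag₂ hk M₁.toBlocks₂₂ M₂.toBlocks₂₂)

theorem diag₂_mul {n k : ℕ} (hk : k ≤ n) (A₁ B₁ : Matrix (Fin k) (Fin k) ℝ)
    (A₂ B₂ : Matrix (Fin (n - k)) (Fin (n - k)) ℝ) :
    diag₂ hk A₁ A₂ * diag₂ hk B₁ B₂ = diag₂ hk (A₁ * B₁) (A₂ * B₂) := by
  simp [diag₂, Matrix.submatrix_mul_equiv, Matrix.fromBlocks_multiply]

theorem diag₂_add {n k : ℕ} (hk : k ≤ n) (A₁ B₁ : Matrix (Fin k) (Fin k) ℝ)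
    (A₂ B₂ : Matrix (Fin (n - k)) (Fin (n - k)) ℝ) :
    diag₂ hk A₁ A₂ + diag₂ hk B₁ B₂ = diag₂ hk (A₁ + B₁) (A₂ + B₂) := by
  have h := Matrix.fromBlocks_add A₁ 0 0 A₂ B₁ 0 0 B₂
  simp only [add_zero] at h
  simp only [diag₂, Matrix.reindex_apply, ← h]
  rfl

theorem diag₂_sub {n k : ℕ} (hk : k ≤ n) (A₁ B₁ : Matrix (Fin k) (Fin k) ℝ)
    (A₂ B₂ : Matrix (Fin (n - k)) (Fin (n - k)) ℝ) :
    diag₂ hk A₁ A₂ - diag₂ hk B₁ B₂ = diag₂ hk (A₁ - B₁) (A₂ - B₂) := by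
  rw [sub_eq_iff_eq_add, diag₂_add, sub_add_cancel, sub_add_cancel]

theorem diag₂_transpose {n k : ℕ} (hk : k ≤ n) (A₁ : Matrix (Fin k) (Fin k) ℝ)
    (A₂ : Matrix (Fin (n - k)) (Fin (n - k)) ℝ) :
    (diag₂ hk A₁ A₂)ᵀ = diag₂ hk A₁ᵀ A₂ᵀ := by
  simp [diag₂, Matrix.fromBlocks_transpose]

theorem diag₂_one {n k : ℕ} (hk : k ≤ n) : diag₂ hk 1 1 = 1 := by
  simp [diag₂, Matrix.fromBlocks_one]

theorem diag₂_zero {n k : ℕ} (hk : k ≤ n) : diag₂ hk 0 0 = 0 := by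
  simp [diag₂]

theorem diag₂_inj {n k : ℕ} (hk : k ≤ n) {A₁ B₁ : Matrix (Fin k) (Fin k) ℝ}
    {A₂ B₂ : Matrix (Fin (n - k)) (Fin (n - k)) ℝ} :
    diag₂ hk A₁ A₂ = diag₂ hk B₁ B₂ ↔ A₁ = B₁ ∧ A₂ = B₂ := by
  rw [diag₂, diag₂, (Matrix.reindex (split hk) (split hk)).injective.eq_iff,
    Matrix.fromBlocks_inj]
  simp

theorem blockMat_mem {n k : ℕ} (hk : k ≤ n) (M₁ : Sp k) (M₂ : Sp (n - k)) :
    blockMat hk M₁.1 M₂.1 ∈ Matrix.symplecticGroup (Fin n) ℝ := by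
  obtain ⟨M₁, h₁⟩ := M₁
  obtain ⟨M₂, h₂⟩ := M₂
  rw [← M₁.fromBlocks_toBlocks, SymplecticGroup.fromBlocks_mem_iff] at h₁
  rw [← M₂.fromBlocks_toBlocks, SymplecticGroup.fromBlocks_mem_iff] at h₂
  rw [blockMat, SymplecticGroup.fromBlocks_mem_iff]
  simp only [diag₂_transpose, diag₂_mul, diag₂_sub, ← diag₂_one hk, diag₂_inj]
  exact ⟨⟨h₁.1, h₂.1⟩, ⟨h₁.2.1, h₂.2.1⟩, ⟨h₁.2.2, h₂.2.2⟩⟩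

theorem blockMat_fromBlocks {n k : ℕ} (hk : k ≤ n) (A₁ B₁ C₁ D₁ : Matrix (Fin k) (Fin k) ℝ)
    (A₂ B₂ C₂ D₂ : Matrix (Fin (n - k)) (Fin (n - k)) ℝ) :
    blockMat hk (Matrix.fromBlocks A₁ B₁ C₁ D₁) (Matrix.fromBlocks A₂ B₂ C₂ D₂) =
      Matrix.fromBlocks (diag₂ hk A₁ A₂) (diag₂ hk B₁ B₂) (diag₂ hk C₁ C₂) (diag₂ hk D₁ D₂) :=
  rfl

theorem blockMat_mul {n k : ℕ} (hk : k ≤ n) (M₁ N₁ : Mat k k) (M₂ N₂ : Mat (n - k) (n - k)) :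
    blockMat hk (M₁ * N₁) (M₂ * N₂) = blockMat hk M₁ M₂ * blockMat hk N₁ N₂ := by
  rw [← M₁.fromBlocks_toBlocks, ← N₁.fromBlocks_toBlocks, ← M₂.fromBlocks_toBlocks,
    ← N₂.fromBlocks_toBlocks]
  simp only [blockMat_fromBlocks, Matrix.fromBlocks_multiply, diag₂_mul, diag₂_add]

theorem blockMat_one {n k : ℕ} (hk : k ≤ n) : blockMat hk 1 1 = 1 := by
  have h := blockMat_fromBlocks hk 1 0 0 1 1 0 0 1
  rwa [Matrix.fromBlocks_one, Matrix.fromBlocks_one, diag₂_one, diag₂_zero,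
    Matrix.fromBlocks_one] at h

/-- The block embedding `Sp(2k) × Sp(2(n-k)) → Sp(2n)`. -/
def blockHom {n k : ℕ} (hk : k ≤ n) : Sp k × Sp (n - k) →* Sp n where
  toFun M := ⟨blockMat hk M.1.1 M.2.1, blockMat_mem hk M.1 M.2⟩
  map_one' := Subtype.ext (blockMat_one hk)
  map_mul' _ _ := Subtype.ext (blockMat_mul hk _ _ _ _)

theorem blockHom_injective {n k : ℕ} (hk : k ≤ n) : Function.Injective (blockHom hk) := by
  rintro ⟨⟨M₁, _⟩, ⟨M₂, _⟩⟩ ⟨⟨N₁, _⟩, ⟨N₂, _⟩⟩ h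
  have h' : blockMat hk M₁ M₂ = blockMat hk N₁ N₂ := congrArg Subtype.val h
  rw [blockMat, blockMat, Matrix.fromBlocks_inj] at h'
  simp only [diag₂_inj] at h'
  have e₁ : M₁ = N₁ := by
    rw [← M₁.fromBlocks_toBlocks, ← N₁.fromBlocks_toBlocks]; simp [h']
  have e₂ : M₂ = N₂ := by
    rw [← M₂.fromBlocks_toBlocks, ← N₂.fromBlocks_toBlocks]; simp [h']
  subst e₁ e₂; rfl

/-- The subgroup `Sp(2k) × Sp(2(n-k))` of `Sp(2n)`. -/
def blockSubgroup {n k : ℕ} (hk : k ≤ n) : Subgroup (Sp n) := (blockHom hk).range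

section Smooth

variable (d e : ℕ) {X Y : Type*}
  [TopologicalSpace X] [ChartedSpace (EuclideanSpace ℝ (Fin d)) X]
  [TopologicalSpace Y] [ChartedSpace (EuclideanSpace ℝ (Fin e)) Y]

/-- The map `ι` from the `d`-dimensional smooth manifold `X` to `ℝ^{2n × 2n}` is a smooth
embedding: a smooth immersion that is a homeomorphism onto its image. -/
structure IsEmbeddedVia {n : ℕ} (ι : X → Fin n ⊕ Fin n → Fin n ⊕ Fin n → ℝ) : Prop where
  isManifold : IsManifold (𝓡 d) ∞ X
  isEmbedding : Topology.IsEmbedding ι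
  contMDiff : ContMDiff (𝓡 d) 𝓘(ℝ, Fin n ⊕ Fin n → Fin n ⊕ Fin n → ℝ) ∞ ι
  immersion : ∀ x, Function.Injective
    (mfderiv (𝓡 d) 𝓘(ℝ, Fin n ⊕ Fin n → Fin n ⊕ Fin n → ℝ) ι x)

/-- The map `f` between smooth manifolds is a surjective smooth submersion. -/
structure IsSurjectiveSubmersion (f : X → Y) : Prop where
  surjective : Function.Surjective f
  contMDiff : ContMDiff (𝓡 d) (𝓡 e) ∞ f
  submersion : ∀ x, Function.Surjective (mfderiv (𝓡 d) (𝓡 e) f x)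

end Smooth

end SpGrassmann

end

open SpGrassmann

namespace SpGrassmann

/-! ### The symplectic inverse -/

/-! The map `A ↦ A⁺` is the adjoint for `ω₀` (`omega_mulVec`). Since `ω₀` is nondegenerate, an
idempotent with `P⁺ = P` has as kernel the symplectic complement of its range, so it is a symplectic
projection. Conversely a symplectic subspace has a symplectic basis (`exists_symplectic_family`);
its vectors are the columns of some `U` with `U⁺U = 1`, and `UU⁺` is the projection onto it. A
projection is determined by its range and kernel, which gives uniqueness.

Factoring both `P = UU⁺` and `1 - P = U'U'⁺` yields a symplectic matrix that carries `E₀` to `P`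
(`exists_smul_E₀_eq`), so `Sp(2n)` acts transitively by conjugation. The stabilizer of `E₀` is its
commutant, the block subgroup (`mem_blockSubgroup_iff`).

All smooth structures come from `LocalParam`: parametrizations of a subset of a normed space whose
inverses extend smoothly to open sets of that space. Such a subset is automatically an embedded
manifold, and smoothness of a map into it can be tested in the ambient space. For `Sp(2n)` the
parametrization is a translated Cayley transform. For the Grassmannian it sends `B` to the
projection onto the graph of `B` over the range of `E₀`, conjugated by a group element. The coset
space is embedded through its bijection with the Grassmannian, so smoothness of that bijection and
its inverse is immediate.

What remains is that the bijection is a homeomorphism for the quotient topology and that the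
quotient map is a submersion. Both follow from the explicit slice `cayleyShift`: in graph
coordinates the orbit map along it is `B ↦ 2B(1 - B⁺B)⁻¹`, with derivative `2 · id` at `0`. -/

theorem stdJ_transpose (n : ℕ) : (stdJ n)ᵀ = -stdJ n := by
  simp [stdJ, Matrix.fromBlocks_transpose, Matrix.fromBlocks_neg]

theorem stdJ_mul_stdJ (n : ℕ) : stdJ n * stdJ n = -1 := by
  simp [stdJ, Matrix.fromBlocks_multiply, ← Matrix.fromBlocks_one, Matrix.fromBlocks_neg]

theorem stdJ_mul_cancel {n k : ℕ} (A : Mat n k) : stdJ n * (stdJ n * A) = -A := by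
  rw [← Matrix.mul_assoc, stdJ_mul_stdJ, Matrix.neg_mul, Matrix.one_mul]

theorem sympInv_mul {n k l : ℕ} (A : Mat n k) (B : Mat k l) :
    sympInv (A * B) = sympInv B * sympInv A := by
  simp [sympInv, stdJ_transpose, Matrix.mul_assoc, stdJ_mul_cancel]

@[simp] theorem sympInv_sympInv {n k : ℕ} (A : Mat n k) : sympInv (sympInv A) = A := by
  simp [sympInv, stdJ_transpose, Matrix.mul_assoc, stdJ_mul_stdJ, stdJ_mul_cancel]

@[simp] theorem sympInv_one {n : ℕ} : sympInv (1 : Mat n n) = 1 := by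
  simp [sympInv, stdJ_transpose, stdJ_mul_stdJ]

@[simp] theorem sympInv_zero {n k : ℕ} : sympInv (0 : Mat n k) = 0 := by
  simp [sympInv]

theorem sympInv_add {n k : ℕ} (A B : Mat n k) : sympInv (A + B) = sympInv A + sympInv B := by
  simp [sympInv, Matrix.mul_add, Matrix.add_mul]

theorem sympInv_sub {n k : ℕ} (A B : Mat n k) : sympInv (A - B) = sympInv A - sympInv B := by
  simp [sympInv, Matrix.mul_sub, Matrix.sub_mul]

/-- No invertibility is needed: for singular `A` both inverses take the default value `0`. -/
theorem sympInv_inv {n : ℕ} (A : Mat n n) : sympInv A⁻¹ = (sympInv A)⁻¹ := by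
  have h : (stdJ n)⁻¹ = -stdJ n := Matrix.inv_eq_right_inv (by simp [stdJ_mul_stdJ])
  have h' : (-stdJ n)⁻¹ = stdJ n := Matrix.inv_eq_right_inv (by simp [stdJ_mul_stdJ])
  rw [sympInv, sympInv, stdJ_transpose, Matrix.mul_inv_rev, Matrix.mul_inv_rev, h, h',
    Matrix.transpose_nonsing_inv]
  simp [Matrix.mul_assoc]

theorem sympInv_fromBlocks {n k : ℕ} (A B C D : Matrix (Fin n) (Fin k) ℝ) :
    sympInv (Matrix.fromBlocks A B C D) = Matrix.fromBlocks Dᵀ (-Bᵀ) (-Cᵀ) Aᵀ := by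
  simp [sympInv, stdJ, Matrix.fromBlocks_transpose, Matrix.fromBlocks_multiply]

theorem sympInv_mul_self {n : ℕ} (M : Sp n) : sympInv (M : Mat n n) * (M : Mat n n) = 1 :=
  (mem_symplecticGroup_iff _).1 M.2

theorem mul_sympInv_self {n : ℕ} (M : Sp n) : (M : Mat n n) * sympInv (M : Mat n n) = 1 :=
  mul_eq_one_comm.1 (sympInv_mul_self M)

theorem coe_inv_eq_sympInv {n : ℕ} (M : Sp n) : ((M⁻¹ : Sp n) : Mat n n) = sympInv (M : Mat n n) := by
  have h : ((M⁻¹ : Sp n) : Mat n n) * (M : Mat n n) = 1 :=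
    congrArg Subtype.val (inv_mul_cancel M)
  calc ((M⁻¹ : Sp n) : Mat n n) = ((M⁻¹ : Sp n) : Mat n n) * (M * sympInv (M : Mat n n)) := by
        rw [mul_sympInv_self, Matrix.mul_one]
    _ = _ := by rw [← Matrix.mul_assoc, h, Matrix.one_mul]

/-! ### The complementary inclusion -/

/-- The last `n - k` columns of `Iₙ`. -/
def coinclMat {n k : ℕ} (hk : k ≤ n) : Matrix (Fin n) (Fin (n - k)) ℝ :=
  (Matrix.fromRows 0 1).submatrix (split hk).symm id

/-- The counterpart of `stdE` for the last `n - k` indices of each half. -/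
noncomputable def coE {n k : ℕ} (hk : k ≤ n) : Mat n (n - k) :=
  Matrix.fromBlocks (coinclMat hk) 0 0 (coinclMat hk)

/-- Written along `split`, products of inclusion matrices reduce to products of row and column
blocks. -/
theorem inclMat_eq {n k : ℕ} (hk : k ≤ n) :
    inclMat n k = (Matrix.fromRows 1 0).submatrix (split hk).symm id := by
  ext i j
  obtain ⟨i, rfl⟩ := (split hk).surjective i
  rcases i with i | i
  · simp [inclMat, split, Matrix.one_apply, Fin.ext_iff]
  · simp [inclMat, split]
    omega

theorem inclMat_transpose_mul {n k : ℕ} (hk : k ≤ n) : (inclMat n k)ᵀ * inclMat n k = 1 := by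
  rw [inclMat_eq hk, Matrix.transpose_submatrix, Matrix.submatrix_mul_equiv,
    Matrix.transpose_fromRows, Matrix.fromCols_mul_fromRows]
  simp

theorem coinclMat_transpose_mul {n k : ℕ} (hk : k ≤ n) : (coinclMat hk)ᵀ * coinclMat hk = 1 := by
  rw [coinclMat, Matrix.transpose_submatrix, Matrix.submatrix_mul_equiv,
    Matrix.transpose_fromRows, Matrix.fromCols_mul_fromRows]
  simp

theorem inclMat_transpose_mul_coinclMat {n k : ℕ} (hk : k ≤ n) :
    (inclMat n k)ᵀ * coinclMat hk = 0 := by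
  rw [inclMat_eq hk, coinclMat, Matrix.transpose_submatrix, Matrix.submatrix_mul_equiv,
    Matrix.transpose_fromRows, Matrix.fromCols_mul_fromRows]
  simp

theorem diag₂_eq {n k : ℕ} (hk : k ≤ n) (A₁ : Matrix (Fin k) (Fin k) ℝ)
    (A₂ : Matrix (Fin (n - k)) (Fin (n - k)) ℝ) :
    diag₂ hk A₁ A₂ = inclMat n k * A₁ * (inclMat n k)ᵀ +
      coinclMat hk * A₂ * (coinclMat hk)ᵀ := by
  have h₁ : A₁ = A₁.submatrix id id := rfl
  have h₂ : A₂ = A₂.submatrix id id := rfl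
  rw [inclMat_eq hk, coinclMat, h₁, h₂, Matrix.transpose_submatrix, Matrix.transpose_submatrix,
    Matrix.submatrix_mul _ _ _ _ _ Function.bijective_id |>.symm,
    Matrix.submatrix_mul _ _ _ _ _ Function.bijective_id |>.symm,
    Matrix.submatrix_mul _ _ _ _ _ Function.bijective_id |>.symm,
    Matrix.submatrix_mul _ _ _ _ _ Function.bijective_id |>.symm]
  rw [diag₂, Matrix.reindex_apply]
  ext i j
  obtain ⟨i, rfl⟩ := (split hk).surjective i
  obtain ⟨j, rfl⟩ := (split hk).surjective j
  rcases i with i | i <;> rcases j with j | j <;>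
    simp [Matrix.fromRows_mul, Matrix.mul_apply, Matrix.one_apply]

theorem sympInv_stdE (n k : ℕ) :
    sympInv (stdE n k) = Matrix.fromBlocks (inclMat n k)ᵀ 0 0 (inclMat n k)ᵀ := by
  simp [stdE, sympInv_fromBlocks]

theorem sympInv_coE {n k : ℕ} (hk : k ≤ n) :
    sympInv (coE hk) = Matrix.fromBlocks (coinclMat hk)ᵀ 0 0 (coinclMat hk)ᵀ := by
  simp [coE, sympInv_fromBlocks]

theorem sympInv_stdE_mul {n k : ℕ} (hk : k ≤ n) : sympInv (stdE n k) * stdE n k = 1 := by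
  rw [sympInv_stdE, stdE]
  simp [Matrix.fromBlocks_multiply, inclMat_transpose_mul hk]

theorem sympInv_coE_mul {n k : ℕ} (hk : k ≤ n) : sympInv (coE hk) * coE hk = 1 := by
  rw [sympInv_coE, coE]
  simp [Matrix.fromBlocks_multiply, coinclMat_transpose_mul hk]

theorem sympInv_stdE_mul_coE {n k : ℕ} (hk : k ≤ n) : sympInv (stdE n k) * coE hk = 0 := by
  simp [sympInv_stdE, coE, Matrix.fromBlocks_multiply, inclMat_transpose_mul_coinclMat hk]

theorem sympInv_coE_mul_stdE {n k : ℕ} (hk : k ≤ n) : sympInv (coE hk) * stdE n k = 0 := by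
  have h := congrArg sympInv (sympInv_stdE_mul_coE hk)
  rwa [sympInv_mul, sympInv_sympInv, sympInv_zero] at h

/-- Replaces index computations by algebra with the two mutually orthogonal frames `stdE` and `coE`.
-/
theorem blockMat_eq {n k : ℕ} (hk : k ≤ n) (M₁ : Mat k k) (M₂ : Mat (n - k) (n - k)) :
    blockMat hk M₁ M₂ = stdE n k * M₁ * sympInv (stdE n k) + coE hk * M₂ * sympInv (coE hk) := by
  conv_rhs => rw [← M₁.fromBlocks_toBlocks, ← M₂.fromBlocks_toBlocks]
  rw [sympInv_stdE, sympInv_coE, stdE, coE]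
  simp [blockMat, Matrix.fromBlocks_multiply, Matrix.fromBlocks_add, diag₂_eq]

theorem stdE_mul_add {n k : ℕ} (hk : k ≤ n) :
    stdE n k * sympInv (stdE n k) + coE hk * sympInv (coE hk) = 1 := by
  simpa [blockMat_one] using (blockMat_eq hk 1 1).symm

/-! ### The symplectic form -/

theorem omega_apply {n : ℕ} (x y : Fin n ⊕ Fin n → ℝ) : omega n x y = x ⬝ᵥ (stdJ n *ᵥ y) := by
  simp [omega, Matrix.toBilin'_apply']

theorem omega_isAlt (n : ℕ) : (omega n).IsAlt := by
  intro x
  have h : x ⬝ᵥ (stdJ n *ᵥ x) = -(x ⬝ᵥ (stdJ n *ᵥ x)) := by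
    conv_lhs => rw [dotProduct_comm, ← Matrix.vecMul_transpose, ← Matrix.dotProduct_mulVec,
      stdJ_transpose, Matrix.neg_mulVec, dotProduct_neg]
  rw [omega_apply]; linarith

/-- The adjunction is the matrix identity `J A⁺ = Aᵀ J`, a consequence of `J² = -1`. -/
theorem omega_mulVec {n k : ℕ} (A : Mat n k) (x : Fin k ⊕ Fin k → ℝ) (y : Fin n ⊕ Fin n → ℝ) :
    omega n (A *ᵥ x) y = omega k x (sympInv A *ᵥ y) := by
  have h : stdJ k * sympInv A = Aᵀ * stdJ n := by
    simp [sympInv, stdJ_transpose, Matrix.mul_assoc, stdJ_mul_cancel]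
  rw [omega_apply, omega_apply, Matrix.mulVec_mulVec, h, ← Matrix.mulVec_mulVec,
    ← Matrix.vecMul_transpose, ← Matrix.dotProduct_mulVec]

theorem eq_zero_of_omega {n : ℕ} {y : Fin n ⊕ Fin n → ℝ} (h : ∀ x, omega n x y = 0) : y = 0 := by
  have h1 : stdJ n *ᵥ y = 0 := by
    simp only [omega_apply] at h
    exact dotProduct_eq_zero _ fun x => by rw [dotProduct_comm, h]
  have h2 : -y = stdJ n *ᵥ (stdJ n *ᵥ y) := by
    rw [Matrix.mulVec_mulVec, stdJ_mul_stdJ, Matrix.neg_mulVec, Matrix.one_mulVec]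
  rw [h1, Matrix.mulVec_zero] at h2
  exact neg_eq_zero.1 h2

/-- Symplectic Gram–Schmidt: split off a hyperbolic plane spanned by `e` and `f`, and recurse on its
complement inside `W`. -/
theorem exists_symplectic_family {V : Type*} [AddCommGroup V] [Module ℝ V] [FiniteDimensional ℝ V]
    {B : LinearMap.BilinForm ℝ V} (hB : B.IsAlt) (k : ℕ) (W : Submodule ℝ V)
    (hW : ∀ w ∈ W, (∀ u ∈ W, B w u = 0) → w = 0) (hd : Module.finrank ℝ W = 2 * k) :
    ∃ e f : Fin k → V, (∀ i, e i ∈ W) ∧ (∀ i, f i ∈ W) ∧ (∀ i j, B (e i) (e j) = 0) ∧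
      (∀ i j, B (f i) (f j) = 0) ∧ ∀ i j, B (e i) (f j) = if i = j then 1 else 0 := by
  have skew : ∀ x y, B x y = -B y x := fun x y => (hB.neg_eq y x).symm
  induction k generalizing W with
  | zero => exact ⟨Fin.elim0, Fin.elim0, by simp⟩
  | succ k ih =>
    have hne : W ≠ ⊥ := by
      rintro rfl
      simp at hd
    obtain ⟨e, heW, he0⟩ := W.ne_bot_iff.1 hne
    obtain ⟨u, huW, hu⟩ : ∃ u ∈ W, B e u ≠ 0 := by
      by_contra! h
      exact he0 (hW e heW h)
    set f := (B e u)⁻¹ • u with hf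
    have hfW : f ∈ W := W.smul_mem _ huW
    have hef : B e f = 1 := by simp [hf, hu]
    have hfe : B f e = -1 := by rw [skew, hef]
    -- The kernel of `L` is the complement of the plane in `W`; surjectivity of `L` makes its
    -- dimension drop by exactly two.
    let L : W →ₗ[ℝ] ℝ × ℝ := ((B e).prod (B f)).comp W.subtype
    have hL : Function.Surjective L := by
      rintro ⟨a, b⟩
      refine ⟨⟨a • f - b • e, W.sub_mem (W.smul_mem _ hfW) (W.smul_mem _ heW)⟩, ?_⟩
      simp [L, hef, hfe, hB.self_eq_zero]
    set W' : Submodule ℝ V := (LinearMap.ker L).map W.subtype with hW'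
    have memW' : ∀ w, w ∈ W' ↔ w ∈ W ∧ B e w = 0 ∧ B f w = 0 := by
      intro w
      simp [hW', L, and_comm]
      tauto
    have hd' : Module.finrank ℝ W' = 2 * k := by
      have h1 := L.finrank_range_add_finrank_ker
      rw [LinearMap.range_eq_top.2 hL, finrank_top, hd] at h1
      rw [hW', Submodule.finrank_map_subtype_eq]
      simp at h1
      omega
    obtain ⟨e', f', h₁, h₂, h₃, h₄, h₅⟩ := ih W' (by
      intro w hw h
      obtain ⟨hwW, hew, hfw⟩ := (memW' w).1 hw
      refine hW w hwW fun v hv => ?_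
      -- This is `v` minus its component in the plane. As `w` is orthogonal to `e` and `f`, the
      -- correction does not change `B w v`, so nondegeneracy passes to `W'`.
      have hmem : v - (B e v) • f + (B f v) • e ∈ W' := by
        rw [memW']
        refine ⟨W.add_mem (W.sub_mem hv (W.smul_mem _ hfW)) (W.smul_mem _ heW), ?_, ?_⟩ <;>
        simp [hef, hfe, hB.self_eq_zero]
      have := h _ hmem
      have h1 : B w e = 0 := by rw [skew, hew, neg_zero]
      have h2 : B w f = 0 := by rw [skew, hfw, neg_zero]
      simpa [h1, h2] using this) hd'
    simp only [memW'] at h₁ h₂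
    have h₁' : ∀ i, B (e' i) e = 0 := fun i => by rw [skew, (h₁ i).2.1, neg_zero]
    have h₁'' : ∀ i, B (e' i) f = 0 := fun i => by rw [skew, (h₁ i).2.2, neg_zero]
    have h₂' : ∀ i, B (f' i) f = 0 := fun i => by rw [skew, (h₂ i).2.2, neg_zero]
    refine ⟨Fin.cons e e', Fin.cons f f', ?_, ?_, ?_, ?_, ?_⟩
    · exact Fin.cases heW fun i => (h₁ i).1
    · exact Fin.cases hfW fun i => (h₂ i).1
    · refine Fin.cases (Fin.cases ?_ fun j => ?_) fun i => Fin.cases ?_ fun j => ?_ <;>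
        simp [hB.self_eq_zero, h₁, h₁', h₃]
    · refine Fin.cases (Fin.cases ?_ fun j => ?_) fun i => Fin.cases ?_ fun j => ?_ <;>
        simp [hB.self_eq_zero, h₂, h₂', h₄]
    · refine Fin.cases (Fin.cases ?_ fun j => ?_) fun i => Fin.cases ?_ fun j => ?_ <;>
        simp [hef, h₂, h₁'', h₅, Fin.ext_iff]



/-! ### Symplectic projections -/

theorem mem_SpGr_of_mem_SpSt {n k : ℕ} {U : Mat n k} (hU : U ∈ SpSt n k) :
    U * sympInv U ∈ SpGr n k := by
  have hU' : sympInv U * U = 1 := hU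
  refine ⟨?_, le_antisymm ?_ ?_, ?_⟩
  · rw [sq, Matrix.mul_assoc, ← Matrix.mul_assoc (sympInv U), hU', Matrix.one_mul]
  · refine (Matrix.rank_mul_le_left _ _).trans ((Matrix.rank_le_card_width _).trans_eq ?_)
    simp [two_mul]
  · have h : sympInv U * (U * sympInv U * U) = 1 := by
      rw [Matrix.mul_assoc U, hU', Matrix.mul_one, hU']
    calc 2 * k = (1 : Mat k k).rank := by simp [Matrix.rank_one, two_mul]
      _ ≤ (U * sympInv U * U).rank := h ▸ Matrix.rank_mul_le_right _ _
      _ ≤ _ := Matrix.rank_mul_le_left _ _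
  · rw [sympInv_mul, sympInv_sympInv]

theorem exists_mem_SpSt_range_eq {n k : ℕ} {W : Submodule ℝ (Fin n ⊕ Fin n → ℝ)}
    (hW : IsSymplecticSubspace W) (hd : Module.finrank ℝ W = 2 * k) :
    ∃ U ∈ SpSt n k, LinearMap.range U.mulVecLin = W := by
  obtain ⟨e, f, he, hf, hee, hff, hef⟩ := exists_symplectic_family (omega_isAlt n) k W
    (fun w hw h => by
      have : w ∈ sympCompl W ⊓ W := ⟨h, hw⟩
      rwa [show sympCompl W ⊓ W = ⊥ from hW] at this) hd
  let U : Mat n k := Matrix.of fun i j => Sum.elim e f j i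
  have hcol : ∀ j, U *ᵥ Pi.single j 1 = Sum.elim e f j := by
    intro j; ext i; simp [U]
  have hU : sympInv U * U = 1 := by
    -- The left side is the Gram matrix of the columns of `U`, which form a symplectic basis.
    have h : Uᵀ * stdJ n * U = stdJ k := by
      ext i j
      have h1 : (Uᵀ * stdJ n * U) i j = omega n (Sum.elim e f i) (Sum.elim e f j) := by
        rw [omega_apply, ← hcol, ← hcol, Matrix.mulVec_mulVec, ← Matrix.vecMul_transpose,
          ← Matrix.dotProduct_mulVec, Matrix.mulVec_mulVec, ← Matrix.mul_assoc]
        simp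
      rw [h1]
      rcases i with i | i <;> rcases j with j | j
      · simp [hee, stdJ]
      · simp [hef, stdJ, Matrix.one_apply]
      · simp only [Sum.elim_inr, Sum.elim_inl]
        rw [← (omega_isAlt n).neg_eq, hef]
        simp [stdJ, Matrix.one_apply, eq_comm]
      · simp [hff, stdJ]
    rw [sympInv, Matrix.mul_assoc, Matrix.mul_assoc, ← Matrix.mul_assoc Uᵀ, h, stdJ_transpose,
      Matrix.neg_mul, stdJ_mul_stdJ, neg_neg]
  refine ⟨U, hU, Submodule.eq_of_le_of_finrank_le ?_ ?_⟩
  · rintro _ ⟨x, rfl⟩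
    rw [Matrix.mulVecLin_apply, ← Finset.univ_sum_single x, Matrix.mulVec_sum]
    refine W.sum_mem fun j _ => ?_
    have : Pi.single j (x j) = x j • (Pi.single j 1 : Fin k ⊕ Fin k → ℝ) := by
      rw [← Pi.single_smul]; simp
    rw [this, Matrix.mulVec_smul, hcol]
    refine W.smul_mem _ ?_
    rcases j with j | j
    · exact he j
    · exact hf j
  · have hinj : Function.Injective U.mulVecLin := by
      intro x y hxy
      have h := congrArg (fun v => sympInv U *ᵥ v) hxy
      simpa [Matrix.mulVec_mulVec, hU] using h
    rw [hd, LinearMap.finrank_range_of_inj hinj]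
    simp [two_mul]

theorem isSymplecticProjection_mul_sympInv {n k : ℕ} {U : Mat n k} (hU : U ∈ SpSt n k) :
    IsSymplecticProjection (LinearMap.range U.mulVecLin) (U * sympInv U) := by
  have hU' : sympInv U * U = 1 := hU
  refine ⟨?_, le_antisymm ?_ ?_, ?_⟩
  · rw [← sq]; exact (mem_SpGr_of_mem_SpSt hU).1
  · rintro _ ⟨x, rfl⟩
    exact ⟨sympInv U *ᵥ x, by simp⟩
  · rintro _ ⟨x, rfl⟩
    exact ⟨U *ᵥ x, by simp [hU']⟩
  · ext x
    have h1 : x ∈ LinearMap.ker (U * sympInv U).mulVecLin ↔ sympInv U *ᵥ x = 0 := by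
      rw [LinearMap.mem_ker, Matrix.mulVecLin_apply, ← Matrix.mulVec_mulVec]
      constructor
      · intro h
        have := congrArg (fun v => sympInv U *ᵥ v) h
        simpa [Matrix.mulVec_mulVec, ← Matrix.mul_assoc, hU'] using this
      · intro h; rw [h, Matrix.mulVec_zero]
    rw [h1]
    constructor
    · rintro h _ ⟨y, rfl⟩
      rw [← (omega_isAlt n).neg_eq, Matrix.mulVecLin_apply, omega_mulVec, h]
      simp
    · intro h
      refine eq_zero_of_omega fun y => ?_
      rw [← omega_mulVec, ← (omega_isAlt n).neg_eq, neg_eq_zero]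
      exact h _ ⟨y, rfl⟩

/-- Equal ranges give `PQ = Q`, and equal kernels give `PQ = P`. -/
theorem IsSymplecticProjection.unique {n : ℕ} {W : Submodule ℝ (Fin n ⊕ Fin n → ℝ)}
    {P Q : Mat n n} (hP : IsSymplecticProjection W P) (hQ : IsSymplecticProjection W Q) :
    P = Q := by
  have h1 : P * Q = Q := by
    refine Matrix.toLin'.injective (LinearMap.ext fun x => ?_)
    have hx : Q.mulVecLin x ∈ LinearMap.range P.mulVecLin := by
      rw [hP.range_eq, ← hQ.range_eq]; exact ⟨x, rfl⟩
    obtain ⟨y, hy⟩ := hx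
    simp only [Matrix.mulVecLin_apply] at hy
    simp only [Matrix.toLin'_apply]
    rw [← Matrix.mulVec_mulVec, ← hy, Matrix.mulVec_mulVec, hP.idem]
  have h2 : P * Q = P := by
    refine Matrix.toLin'.injective (LinearMap.ext fun x => ?_)
    have hx : x - Q *ᵥ x ∈ LinearMap.ker P.mulVecLin := by
      rw [hP.ker_eq, ← hQ.ker_eq]
      simp [Matrix.mulVec_sub, Matrix.mulVec_mulVec, hQ.idem]
    simp only [LinearMap.mem_ker, Matrix.mulVecLin_apply, Matrix.mulVec_sub,
      Matrix.mulVec_mulVec, sub_eq_zero] at hx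
    simpa using hx.symm
  rw [← h2, h1]

theorem isSymplecticProjection_range {n k : ℕ} {P : Mat n n} (hP : P ∈ SpGr n k) :
    IsSymplecticProjection (LinearMap.range P.mulVecLin) P := by
  obtain ⟨h1, -, h3⟩ := hP
  refine ⟨by rw [← sq, h1], rfl, ?_⟩
  ext x
  rw [LinearMap.mem_ker, Matrix.mulVecLin_apply]
  constructor
  · rintro h _ ⟨y, rfl⟩
    rw [← (omega_isAlt n).neg_eq, Matrix.mulVecLin_apply, omega_mulVec, h3, h]
    simp
  · intro h
    refine eq_zero_of_omega fun y => ?_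
    rw [← h3, ← omega_mulVec, ← (omega_isAlt n).neg_eq, neg_eq_zero]
    exact h _ ⟨y, rfl⟩

theorem isSymplecticSubspace_range {n k : ℕ} {P : Mat n n} (hP : P ∈ SpGr n k) :
    IsSymplecticSubspace (LinearMap.range P.mulVecLin) := by
  have h := isSymplecticProjection_range hP
  rw [IsSymplecticSubspace, ← h.ker_eq, eq_bot_iff]
  rintro _ ⟨hx, y, rfl⟩
  simp only [SetLike.mem_coe, LinearMap.mem_ker, Matrix.mulVecLin_apply, Matrix.mulVec_mulVec,
    h.idem] at hx
  exact hx

theorem exists_eq_mul_sympInv {n k : ℕ} {P : Mat n n} (hP : P ∈ SpGr n k) :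
    ∃ U ∈ SpSt n k, P = U * sympInv U := by
  obtain ⟨U, hU, hr⟩ := exists_mem_SpSt_range_eq (isSymplecticSubspace_range hP) hP.2.1
  exact ⟨U, hU, (isSymplecticProjection_range hP).unique
    (hr ▸ isSymplecticProjection_mul_sympInv hU)⟩

theorem existsUnique_isSymplecticProjection {n k : ℕ} {W : Submodule ℝ (Fin n ⊕ Fin n → ℝ)}
    (hW : IsSymplecticSubspace W) (hd : Module.finrank ℝ W = 2 * k) :
    ∃! P, IsSymplecticProjection W P := by
  obtain ⟨U, hU, rfl⟩ := exists_mem_SpSt_range_eq hW hd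
  exact ⟨_, isSymplecticProjection_mul_sympInv hU,
    fun Q hQ => hQ.unique (isSymplecticProjection_mul_sympInv hU)⟩

theorem SpGr_eq (n k : ℕ) : SpGr n k = {P | ∃ W, IsSymplecticSubspace W ∧
    Module.finrank ℝ W = 2 * k ∧ IsSymplecticProjection W P} := by
  ext P
  constructor
  · intro hP
    exact ⟨_, isSymplecticSubspace_range hP, hP.2.1, isSymplecticProjection_range hP⟩
  · rintro ⟨W, hW, hd, hP⟩
    obtain ⟨U, hU, rfl⟩ := exists_mem_SpSt_range_eq hW hd
    rw [hP.unique (isSymplecticProjection_mul_sympInv hU)]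
    exact mem_SpGr_of_mem_SpSt hU

/-! ### The action of the symplectic group -/

/-- Supplies the complementary frame needed for transitivity. Rank–nullity forces `k ≤ n`, so the
truncated subtraction is exact. -/
theorem one_sub_mem_SpGr {n k : ℕ} {P : Mat n n} (hP : P ∈ SpGr n k) :
    1 - P ∈ SpGr n (n - k) := by
  obtain ⟨h1, h2, h3⟩ := hP
  have h1' : P * P = P := by rw [← sq, h1]
  refine ⟨?_, ?_, ?_⟩
  · simp [sq, Matrix.mul_sub, Matrix.sub_mul, h1']
  · have hr : LinearMap.range (1 - P).mulVecLin = LinearMap.ker P.mulVecLin := by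
      ext x
      constructor
      · rintro ⟨y, rfl⟩
        simp [Matrix.mulVec_sub, Matrix.mulVec_mulVec, h1']
      · intro hx
        exact ⟨x, by simpa [Matrix.sub_mulVec] using hx⟩
    have h := P.mulVecLin.finrank_range_add_finrank_ker
    rw [Matrix.rank, hr]
    rw [Matrix.rank] at h2
    simp at h
    omega
  · rw [sympInv_sub, h3, sympInv_one]

theorem exists_smul_E₀_eq {n k : ℕ} (hk : k ≤ n) {P : Mat n n} (hP : P ∈ SpGr n k) :
    ∃ M : Sp n, (M : Mat n n) * E₀ n k * sympInv (M : Mat n n) = P := by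
  obtain ⟨U, hU, hPU⟩ := exists_eq_mul_sympInv hP
  obtain ⟨U', hU', hPU'⟩ := exists_eq_mul_sympInv (one_sub_mem_SpGr hP)
  replace hU : sympInv U * U = 1 := hU
  replace hU' : sympInv U' * U' = 1 := hU'
  -- The two frames are orthogonal because `P(1 - P) = 0`.
  have hUU' : sympInv U * U' = 0 := by
    have h : U * sympInv U * (U' * sympInv U') = 0 := by
      rw [← hPU, ← hPU', Matrix.mul_sub, Matrix.mul_one, ← sq, hP.1, sub_self]
    calc sympInv U * U' = (sympInv U * U) * (sympInv U * U') * (sympInv U' * U') := by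
          rw [hU, hU', Matrix.one_mul, Matrix.mul_one]
      _ = sympInv U * (U * sympInv U * (U' * sympInv U')) * U' := by simp only [Matrix.mul_assoc]
      _ = 0 := by rw [h, Matrix.mul_zero, Matrix.zero_mul]
  have hU'U : sympInv U' * U = 0 := by
    have h := congrArg sympInv hUU'
    rwa [sympInv_mul, sympInv_sympInv, sympInv_zero] at h
  have c1 : ∀ {l : ℕ} (X : Mat k l), sympInv U * (U * X) = X := fun X => by
    rw [← Matrix.mul_assoc, hU, Matrix.one_mul]
  have c2 : ∀ {l : ℕ} (X : Mat (n - k) l), sympInv U' * (U' * X) = X := fun X => by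
    rw [← Matrix.mul_assoc, hU', Matrix.one_mul]
  have c3 : ∀ {l : ℕ} (X : Mat (n - k) l), sympInv U * (U' * X) = 0 := fun X => by
    rw [← Matrix.mul_assoc, hUU', Matrix.zero_mul]
  have c4 : ∀ {l : ℕ} (X : Mat k l), sympInv U' * (U * X) = 0 := fun X => by
    rw [← Matrix.mul_assoc, hU'U, Matrix.zero_mul]
  have d1 : ∀ {l : ℕ} (X : Mat k l), sympInv (stdE n k) * (stdE n k * X) = X := fun X => by
    rw [← Matrix.mul_assoc, sympInv_stdE_mul hk, Matrix.one_mul]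
  have d4 : ∀ {l : ℕ} (X : Mat k l), sympInv (coE hk) * (stdE n k * X) = 0 := fun X => by
    rw [← Matrix.mul_assoc, sympInv_coE_mul_stdE hk, Matrix.zero_mul]
  have d3 : ∀ {l : ℕ} (X : Mat (n - k) l), sympInv (stdE n k) * (coE hk * X) = 0 := fun X => by
    rw [← Matrix.mul_assoc, sympInv_stdE_mul_coE hk, Matrix.zero_mul]
  -- `M` takes the frame `stdE` to `U` and `coE` to `U'`, hence `E₀ = EE⁺` to `UU⁺ = P`.
  let M : Mat n n := U * sympInv (stdE n k) + U' * sympInv (coE hk)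
  have hM' : sympInv M = stdE n k * sympInv U + coE hk * sympInv U' := by
    simp [M, sympInv_add, sympInv_mul]
  have hM : sympInv M * M = 1 := by
    rw [hM', ← stdE_mul_add hk]
    simp [M, Matrix.add_mul, Matrix.mul_add, Matrix.mul_assoc, c1, c2, c3, c4]
  refine ⟨⟨M, (mem_symplecticGroup_iff M).2 hM⟩, ?_⟩
  change M * E₀ n k * sympInv M = P
  rw [hM', hPU, E₀]
  simp [M, Matrix.add_mul, Matrix.mul_add, Matrix.mul_assoc, d1, d3, d4]

/-- Commuting with `FF⁺` means that `M` preserves the range of `F`; the compression is the matrix of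
the restriction in the frame `F`. -/
theorem compress_mem_symplecticGroup {n l : ℕ} {F : Mat n l} (hF : sympInv F * F = 1)
    {M : Mat n n} (hM : sympInv M * M = 1) (h : M * (F * sympInv F) = F * sympInv F * M) :
    sympInv F * M * F ∈ Matrix.symplecticGroup (Fin l) ℝ := by
  rw [mem_symplecticGroup_iff]
  calc sympInv (sympInv F * M * F) * (sympInv F * M * F)
      = sympInv F * sympInv M * (F * sympInv F * M) * F := by
        simp only [sympInv_mul, sympInv_sympInv, Matrix.mul_assoc]
    _ = sympInv F * (sympInv M * M) * F * (sympInv F * F) := by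
        rw [← h]; simp only [Matrix.mul_assoc]
    _ = 1 := by rw [hM, Matrix.mul_one, hF, Matrix.mul_one]

/-- Fixing `E₀` amounts to commuting with it, hence with `1 - E₀` too. Such an `M` is the sum of its
compressions to the two frames. -/
theorem mem_blockSubgroup_iff {n k : ℕ} (hk : k ≤ n) (M : Sp n) :
    M ∈ blockSubgroup hk ↔ (M : Mat n n) * E₀ n k * sympInv (M : Mat n n) = E₀ n k := by
  have hcomm : (M : Mat n n) * E₀ n k * sympInv (M : Mat n n) = E₀ n k ↔
      (M : Mat n n) * E₀ n k = E₀ n k * (M : Mat n n) := by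
    constructor
    · intro h
      rw [← Matrix.mul_one ((M : Mat n n) * E₀ n k), ← sympInv_mul_self M, ← Matrix.mul_assoc, h]
    · intro h
      rw [h, Matrix.mul_assoc, mul_sympInv_self, Matrix.mul_one]
  have d1 := sympInv_stdE_mul hk
  have d2 := sympInv_coE_mul hk
  have d3 := sympInv_stdE_mul_coE hk
  have d4 := sympInv_coE_mul_stdE hk
  rw [hcomm]
  constructor
  · rintro ⟨⟨M₁, M₂⟩, rfl⟩
    change blockMat hk M₁.1 M₂.1 * _ = _ * blockMat hk M₁.1 M₂.1
    rw [blockMat_eq, E₀]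
    have e1 : sympInv (stdE n k) * (stdE n k * sympInv (stdE n k)) = sympInv (stdE n k) := by
      rw [← Matrix.mul_assoc, d1, Matrix.one_mul]
    have e2 : sympInv (coE hk) * (stdE n k * sympInv (stdE n k)) = 0 := by
      rw [← Matrix.mul_assoc, d4, Matrix.zero_mul]
    have e3 : ∀ X : Mat k n, sympInv (stdE n k) * (stdE n k * X) = X := fun X => by
      rw [← Matrix.mul_assoc, d1, Matrix.one_mul]
    have e4 : ∀ X : Mat (n - k) n, sympInv (stdE n k) * (coE hk * X) = 0 := fun X => by
      rw [← Matrix.mul_assoc, d3, Matrix.zero_mul]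
    simp [Matrix.add_mul, Matrix.mul_add, Matrix.mul_assoc, e1, e2, e3, e4]
  · intro h
    rw [E₀] at h
    have h' : (M : Mat n n) * (coE hk * sympInv (coE hk)) = coE hk * sympInv (coE hk) * (M : Mat n n) := by
      rw [eq_sub_of_add_eq' (stdE_mul_add hk), Matrix.mul_sub, Matrix.sub_mul, h, Matrix.one_mul,
        Matrix.mul_one]
    refine ⟨(⟨_, compress_mem_symplecticGroup d1 (sympInv_mul_self M) h⟩,
      ⟨_, compress_mem_symplecticGroup d2 (sympInv_mul_self M) h'⟩),
      Subtype.ext ?_⟩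
    change blockMat hk (sympInv (stdE n k) * (M : Mat n n) * stdE n k)
      (sympInv (coE hk) * (M : Mat n n) * coE hk) = M
    have e : ∀ {l : ℕ} {F : Mat n l}, sympInv F * F = 1 →
        (M : Mat n n) * (F * sympInv F) = F * sympInv F * (M : Mat n n) →
        F * (sympInv F * (M : Mat n n) * F) * sympInv F = (M : Mat n n) * (F * sympInv F) := by
      intro l F hF hM
      calc F * (sympInv F * (M : Mat n n) * F) * sympInv F = F * sympInv F * (M : Mat n n) * (F * sympInv F) := by
            simp only [Matrix.mul_assoc]
        _ = (M : Mat n n) * (F * (sympInv F * F) * sympInv F) := by rw [← hM]; simp only [Matrix.mul_assoc]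
        _ = _ := by rw [hF, Matrix.mul_one]
    rw [blockMat_eq, e d1 h, e d2 h', ← Matrix.mul_add, stdE_mul_add, Matrix.mul_one]

/-! ### Embedded submanifolds given by local parametrizations -/

section Embedded

open Topology Set

variable {E V X : Type*} [NormedAddCommGroup E] [NormedSpace ℝ E]
  [NormedAddCommGroup V] [NormedSpace ℝ V]

/-- A smooth parametrization `ψ` of a neighbourhood of `x` in the image of `ι : X → V`, with a
smooth left inverse `φ`. -/
structure LocalParam (E : Type*) [NormedAddCommGroup E] [NormedSpace ℝ E] (ι : X → V) (x : X) where
  φ : V → E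
  ψ : E → V
  source : Set V
  target : Set E
  isOpen_source : IsOpen source
  isOpen_target : IsOpen target
  mem_source : ι x ∈ source
  contDiffOn_φ : ContDiffOn ℝ ∞ φ source
  contDiffOn_ψ : ContDiffOn ℝ ∞ ψ target
  ψ_mem_range : ∀ e ∈ target, ψ e ∈ range ι
  ψ_mem_source : ∀ e ∈ target, ψ e ∈ source
  φ_ψ : ∀ e ∈ target, φ (ψ e) = e
  φ_mem_target : ∀ y, ι y ∈ source → φ (ι y) ∈ target
  ψ_φ : ∀ y, ι y ∈ source → ψ (φ (ι y)) = ι y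

namespace LocalParam

variable {ι : X → V} {x : X}

theorem apply_invFun (p : LocalParam E ι x) {e : E} (he : e ∈ p.target) :
    haveI : Nonempty X := ⟨x⟩
    ι (Function.invFun ι (p.ψ e)) = p.ψ e :=
  haveI : Nonempty X := ⟨x⟩
  Function.invFun_eq (p.ψ_mem_range e he)

variable [TopologicalSpace X]

/-- The chart `φ ∘ ι` of a local parametrization. -/
noncomputable def chart (p : LocalParam E ι x) (hι : IsEmbedding ι) : OpenPartialHomeomorph X E :=
  haveI : Nonempty X := ⟨x⟩
  { toFun := fun y => p.φ (ι y)
    invFun := fun e => Function.invFun ι (p.ψ e)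
    source := ι ⁻¹' p.source
    target := p.target
    map_source' := fun y hy => p.φ_mem_target y hy
    map_target' := fun e he => by
      change ι (Function.invFun ι (p.ψ e)) ∈ p.source
      rw [p.apply_invFun he]
      exact p.ψ_mem_source e he
    left_inv' := fun y hy => by
      rw [p.ψ_φ y hy]
      exact Function.leftInverse_invFun hι.injective y
    right_inv' := fun e he => by
      rw [p.apply_invFun he, p.φ_ψ e he]
    open_source := p.isOpen_source.preimage hι.continuous
    open_target := p.isOpen_target
    continuousOn_toFun := p.contDiffOn_φ.continuousOn.comp hι.continuous.continuousOn
      fun y hy => hy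
    continuousOn_invFun := by
      rw [hι.isInducing.continuousOn_iff]
      exact p.contDiffOn_ψ.continuousOn.congr fun e he => p.apply_invFun he }

/-- The charted space structure given by local parametrizations at all points. -/
@[reducible] noncomputable def chartedSpace (hι : IsEmbedding ι) (p : ∀ x, LocalParam E ι x) :
    ChartedSpace E X where
  atlas := range fun x => (p x).chart hι
  chartAt x := (p x).chart hι
  mem_chart_source x := (p x).mem_source
  chart_mem_atlas x := mem_range_self x

variable (hι : IsEmbedding ι) (p : ∀ x, LocalParam E ι x)

/-- The transition maps are `φ ∘ ψ` for two parametrizations, smooth because they pass through `V`.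
-/
theorem isManifold :
    letI := chartedSpace hι p
    IsManifold 𝓘(ℝ, E) ∞ X := by
  let := chartedSpace hι p
  refine isManifold_of_contDiffOn _ _ _ ?_
  rintro _ _ ⟨x, rfl⟩ ⟨y, rfl⟩
  have h : ContDiffOn ℝ ∞ ((p y).φ ∘ (p x).ψ) ((p x).target ∩ (p x).ψ ⁻¹' (p y).source) :=
    (p y).contDiffOn_φ.comp ((p x).contDiffOn_ψ.mono inter_subset_left) inter_subset_right
  simp only [modelWithCornersSelf_coe, modelWithCornersSelf_coe_symm, Function.id_comp,
    Function.comp_id, preimage_id, range_id, inter_univ]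
  have key : ∀ e ∈ (p x).target, ι (((p x).chart hι).symm e) = (p x).ψ e :=
    fun e he => (p x).apply_invFun he
  refine (h.mono ?_).congr ?_
  · rintro e ⟨he, he'⟩
    refine ⟨he, ?_⟩
    change ι (((p x).chart hι).symm e) ∈ (p y).source at he'
    rwa [key e he] at he'
  · rintro e ⟨he, -⟩
    change (p y).φ (ι (((p x).chart hι).symm e)) = _
    rw [key e he]; rfl

theorem contMDiff_coe :
    letI := chartedSpace hι p
    ContMDiff 𝓘(ℝ, E) 𝓘(ℝ, V) ∞ ι := by
  let := chartedSpace hι p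
  have := isManifold hι p
  intro x
  have h1 : ContMDiffAt 𝓘(ℝ, E) 𝓘(ℝ, E) ∞ (fun y => (p x).φ (ι y)) x :=
    contMDiffAt_extChartAt (I := 𝓘(ℝ, E)) (x := x)
  have h2 : ContMDiffAt 𝓘(ℝ, E) 𝓘(ℝ, V) ∞ (p x).ψ ((p x).φ (ι x)) :=
    ((p x).contDiffOn_ψ.contDiffAt
      ((p x).isOpen_target.mem_nhds ((p x).φ_mem_target x (p x).mem_source))).contMDiffAt
  refine (h2.comp x h1).congr_of_eventuallyEq ?_
  filter_upwards [((p x).isOpen_source.preimage hι.continuous).mem_nhds (p x).mem_source] with y hy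
  exact ((p x).ψ_φ y hy).symm

/-- `φ ∘ ι` is the chart at `x`, whose derivative is invertible, so the derivative of `ι` has a left
inverse. -/
theorem mfderiv_injective (x : X) :
    letI := chartedSpace hι p
    Function.Injective (mfderiv 𝓘(ℝ, E) 𝓘(ℝ, V) ι x) := by
  let := chartedSpace hι p
  have := isManifold hι p
  have h1 : MDifferentiableAt 𝓘(ℝ, E) 𝓘(ℝ, V) ι x :=
    (contMDiff_coe hι p x).mdifferentiableAt (by simp)
  have h2 : MDifferentiableAt 𝓘(ℝ, V) 𝓘(ℝ, E) (p x).φ (ι x) :=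
    (((p x).contDiffOn_φ.contDiffAt ((p x).isOpen_source.mem_nhds
      (p x).mem_source)).differentiableAt (by simp)).mdifferentiableAt
  have h3 := mfderiv_comp x h2 h1
  have h4 : (mfderiv 𝓘(ℝ, E) 𝓘(ℝ, E) (extChartAt 𝓘(ℝ, E) x) x).IsInvertible :=
    isInvertible_mfderiv_extChartAt (mem_extChartAt_source x)
  have h5 : mfderiv 𝓘(ℝ, E) 𝓘(ℝ, E) ((p x).φ ∘ ι) x =
      mfderiv 𝓘(ℝ, E) 𝓘(ℝ, E) (extChartAt 𝓘(ℝ, E) x) x := rfl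
  rw [← h5, h3] at h4
  intro a b hab
  exact h4.injective (congrArg (mfderiv 𝓘(ℝ, V) 𝓘(ℝ, E) (p x).φ (ι x)) hab)

/-- The charts are restrictions of smooth maps on open sets of `V`, so composing a smooth `ι ∘ f`
with `φ` gives `f` in coordinates. -/
theorem contMDiffAt_of_comp {H' E' Y : Type*} [NormedAddCommGroup E'] [NormedSpace ℝ E']
    [TopologicalSpace H'] {I' : ModelWithCorners ℝ E' H'} [TopologicalSpace Y]
    [ChartedSpace H' Y] {f : Y → X} {y : Y} (hf : ContMDiffAt I' 𝓘(ℝ, V) ∞ (ι ∘ f) y) :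
    letI := chartedSpace hι p
    ContMDiffAt I' 𝓘(ℝ, E) ∞ f y := by
  let := chartedSpace hι p
  rw [contMDiffAt_iff_target]
  refine ⟨hι.isInducing.continuousAt_iff.2 hf.continuousAt, ?_⟩
  have h2 : ContMDiffAt 𝓘(ℝ, V) 𝓘(ℝ, E) ∞ (p (f y)).φ (ι (f y)) :=
    ((p (f y)).contDiffOn_φ.contDiffAt ((p (f y)).isOpen_source.mem_nhds
      (p (f y)).mem_source)).contMDiffAt
  exact ContMDiffAt.comp (f := ι ∘ f) y h2 hf

theorem contMDiff_of_comp {H' E' Y : Type*} [NormedAddCommGroup E'] [NormedSpace ℝ E']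
    [TopologicalSpace H'] {I' : ModelWithCorners ℝ E' H'} [TopologicalSpace Y]
    [ChartedSpace H' Y] {f : Y → X} (hf : ContMDiff I' 𝓘(ℝ, V) ∞ (ι ∘ f)) :
    letI := chartedSpace hι p
    ContMDiff I' 𝓘(ℝ, E) ∞ f :=
  fun y => contMDiffAt_of_comp hι p (hf y)

/-- Local parametrizations can be transported along an injection onto the same set. -/
def congr {X' : Type*} [TopologicalSpace X'] {x : X} (p : LocalParam E ι x) {ι' : X' → V} {x' : X'}
    (hr : range ι' = range ι) (hx : ι' x' = ι x) : LocalParam E ι' x' where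
  φ := p.φ
  ψ := p.ψ
  source := p.source
  target := p.target
  isOpen_source := p.isOpen_source
  isOpen_target := p.isOpen_target
  mem_source := hx ▸ p.mem_source
  contDiffOn_φ := p.contDiffOn_φ
  contDiffOn_ψ := p.contDiffOn_ψ
  ψ_mem_range e he := hr ▸ p.ψ_mem_range e he
  ψ_mem_source := p.ψ_mem_source
  φ_ψ := p.φ_ψ
  φ_mem_target y hy := by
    obtain ⟨z, hz⟩ := hr ▸ mem_range_self (f := ι') y
    rw [← hz] at hy ⊢
    exact p.φ_mem_target z hy
  ψ_φ y hy := by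
    obtain ⟨z, hz⟩ := hr ▸ mem_range_self (f := ι') y
    rw [← hz] at hy ⊢
    exact p.ψ_φ z hy

end LocalParam

end Embedded

/-! ### Smooth matrix-valued functions -/

section SmoothMat

variable {E : Type*} [NormedAddCommGroup E] [NormedSpace ℝ E] {x : E}
  {m l p : Type*} [Fintype m] [Fintype l] [Fintype p]

/-- Entrywise smoothness of a matrix-valued function at a point. -/
def SmoothMatAt {m l : Type*} (f : E → Matrix m l ℝ) (x : E) : Prop :=
  ∀ i j, ContDiffAt ℝ ∞ (fun y => f y i j) x

theorem SmoothMatAt.contDiffAt {f : E → Matrix m l ℝ} (hf : SmoothMatAt f x) :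
    ContDiffAt ℝ ∞ (fun y i j => f y i j) x :=
  contDiffAt_pi.2 fun i => contDiffAt_pi.2 fun j => hf i j

theorem ContDiffAt.smoothMatAt {f : E → m → l → ℝ} (hf : ContDiffAt ℝ ∞ f x) :
    SmoothMatAt (fun y => Matrix.of (f y)) x :=
  fun i j => contDiffAt_pi.1 (contDiffAt_pi.1 hf i) j

theorem SmoothMatAt.const {m l : Type*} (A : Matrix m l ℝ) : SmoothMatAt (fun _ : E => A) x :=
  fun _ _ => contDiffAt_const

theorem SmoothMatAt.add {m l : Type*} {f g : E → Matrix m l ℝ} (hf : SmoothMatAt f x)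
    (hg : SmoothMatAt g x) : SmoothMatAt (fun y => f y + g y) x :=
  fun i j => (hf i j).add (hg i j)

theorem SmoothMatAt.sub {m l : Type*} {f g : E → Matrix m l ℝ} (hf : SmoothMatAt f x)
    (hg : SmoothMatAt g x) : SmoothMatAt (fun y => f y - g y) x :=
  fun i j => (hf i j).sub (hg i j)

theorem SmoothMatAt.transpose {m l : Type*} {f : E → Matrix m l ℝ} (hf : SmoothMatAt f x) :
    SmoothMatAt (fun y => (f y)ᵀ) x :=
  fun i j => hf j i

omit [Fintype m] [Fintype p] in
theorem SmoothMatAt.mul {f : E → Matrix m l ℝ} {g : E → Matrix l p ℝ} (hf : SmoothMatAt f x)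
    (hg : SmoothMatAt g x) : SmoothMatAt (fun y => f y * g y) x := by
  intro i j
  simp only [Matrix.mul_apply]
  exact ContDiffAt.sum fun a _ => (hf i a).mul (hg a j)

theorem SmoothMatAt.det [DecidableEq m] {f : E → Matrix m m ℝ} (hf : SmoothMatAt f x) :
    ContDiffAt ℝ ∞ (fun y => (f y).det) x := by
  simp only [Matrix.det_apply]
  exact ContDiffAt.sum fun σ _ => (contDiffAt_prod fun i _ => hf _ _).const_smul _

/-- Cramer's rule: each entry of the adjugate is the determinant of `f` with one row replaced by a
constant. -/
theorem SmoothMatAt.inv [DecidableEq m] {f : E → Matrix m m ℝ} (hf : SmoothMatAt f x)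
    (h : (f x).det ≠ 0) : SmoothMatAt (fun y => (f y)⁻¹) x := by
  intro i j
  simp only [Matrix.inv_def, Ring.inverse_eq_inv', Matrix.smul_apply, smul_eq_mul,
    Matrix.adjugate_apply]
  refine (hf.det.inv h).mul (SmoothMatAt.det ?_)
  intro a b
  by_cases ha : a = j
  · subst ha
    simpa using contDiffAt_const
  · simpa [Matrix.updateRow_apply, ha] using hf a b

theorem SmoothMatAt.sympInv {n k : ℕ} {f : E → Mat n k} (hf : SmoothMatAt f x) :
    SmoothMatAt (fun y => sympInv (f y)) x :=
  ((SmoothMatAt.const _).mul hf.transpose).mul (SmoothMatAt.const _)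

theorem isOpen_det_ne_zero [DecidableEq m] {f : E → Matrix m m ℝ} (hf : ∀ x, SmoothMatAt f x) :
    IsOpen {x | (f x).det ≠ 0} :=
  isOpen_ne_fun (continuous_iff_continuousAt.2 fun x => (hf x).det.continuousAt) continuous_const

end SmoothMat

/-! ### The Cayley transform -/

section Cayley

variable {n : ℕ}

/-- The Cayley transform `(1 + X)(1 - X)⁻¹`. -/
noncomputable def cayley (X : Mat n n) : Mat n n := (1 + X) * (1 - X)⁻¹

/-- From `(1 + X) + (1 - X) = 2`. It shows that the image of the Cayley transform lies where its
inverse `A ↦ (A - 1)(A + 1)⁻¹` is defined. -/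
theorem cayley_add_one {X : Mat n n} (h : (1 - X).det ≠ 0) :
    cayley X + 1 = (2 : ℝ) • (1 - X)⁻¹ := by
  have h1 : (1 - X) * (1 - X)⁻¹ = 1 := Matrix.mul_nonsing_inv _ (isUnit_iff_ne_zero.2 h)
  calc cayley X + 1 = (1 + X) * (1 - X)⁻¹ + (1 - X) * (1 - X)⁻¹ := by rw [h1, cayley]
    _ = _ := by rw [← Matrix.add_mul, add_add_sub_cancel, two_smul, Matrix.add_mul, Matrix.one_mul]

theorem det_two_smul_inv_ne_zero {X : Mat n n} (h : X.det ≠ 0) :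
    ((2 : ℝ) • X⁻¹).det ≠ 0 := by
  rw [Matrix.det_smul]
  refine mul_ne_zero (by positivity) ?_
  exact (Matrix.isUnit_nonsing_inv_det _ (isUnit_iff_ne_zero.2 h)).ne_zero

theorem det_cayley_add_one_ne_zero {X : Mat n n} (h : (1 - X).det ≠ 0) :
    (cayley X + 1).det ≠ 0 := by
  rw [cayley_add_one h]
  exact det_two_smul_inv_ne_zero h

theorem cayley_sub_one_mul_inv {X : Mat n n} (h : (1 - X).det ≠ 0) :
    (cayley X - 1) * (cayley X + 1)⁻¹ = X := by
  have h1 : (1 - X) * (1 - X)⁻¹ = 1 := Matrix.mul_nonsing_inv _ (isUnit_iff_ne_zero.2 h)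
  have h2 : cayley X - 1 = X * (cayley X + 1) := by
    rw [cayley_add_one h]
    calc cayley X - 1 = (1 + X) * (1 - X)⁻¹ - (1 - X) * (1 - X)⁻¹ := by rw [h1, cayley]
      _ = _ := by rw [← Matrix.sub_mul, add_sub_sub_cancel, Matrix.add_mul, Matrix.mul_smul, two_smul]
  rw [h2, Matrix.mul_nonsing_inv_cancel_right _ _
    (isUnit_iff_ne_zero.2 (det_cayley_add_one_ne_zero h))]

theorem one_sub_cayley_inv {A : Mat n n} (h : (A + 1).det ≠ 0) :
    1 - (A - 1) * (A + 1)⁻¹ = (2 : ℝ) • (A + 1)⁻¹ := by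
  have h1 : (A + 1) * (A + 1)⁻¹ = 1 := Matrix.mul_nonsing_inv _ (isUnit_iff_ne_zero.2 h)
  calc 1 - (A - 1) * (A + 1)⁻¹ = (A + 1) * (A + 1)⁻¹ - (A - 1) * (A + 1)⁻¹ := by rw [h1]
    _ = _ := by rw [← Matrix.sub_mul, add_sub_sub_cancel, Matrix.add_mul, two_smul, Matrix.one_mul]

theorem cayley_cayley_inv {A : Mat n n} (h : (A + 1).det ≠ 0) :
    cayley ((A - 1) * (A + 1)⁻¹) = A := by
  have h1 : (A + 1) * (A + 1)⁻¹ = 1 := Matrix.mul_nonsing_inv _ (isUnit_iff_ne_zero.2 h)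
  have h2 := one_sub_cayley_inv h
  have h3 : 1 + (A - 1) * (A + 1)⁻¹ = A * (1 - (A - 1) * (A + 1)⁻¹) := by
    rw [h2]
    calc 1 + (A - 1) * (A + 1)⁻¹ = (A + 1) * (A + 1)⁻¹ + (A - 1) * (A + 1)⁻¹ := by rw [h1]
      _ = _ := by rw [← Matrix.add_mul, add_add_sub_cancel, Matrix.add_mul, Matrix.mul_smul, two_smul]
  rw [cayley, h3, Matrix.mul_nonsing_inv_cancel_right]
  rw [h2]
  exact isUnit_iff_ne_zero.2 (det_two_smul_inv_ne_zero h)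

/-- The Cayley transform takes the Lie algebra `X⁺ = -X` into the group: `⁺` exchanges `1 + X` and
`1 - X`, which commute. -/
theorem sympInv_cayley_mul {X : Mat n n} (hX : sympInv X = -X) (h : (1 - X).det ≠ 0) :
    sympInv (cayley X) * cayley X = 1 := by
  have h1 : (1 - X) * (1 - X)⁻¹ = 1 := Matrix.mul_nonsing_inv _ (isUnit_iff_ne_zero.2 h)
  have h2 : sympInv (1 - X)⁻¹ * (1 + X) = 1 := by
    have := congrArg sympInv h1
    rwa [sympInv_mul, sympInv_sub, sympInv_one, hX, sub_neg_eq_add] at this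
  have h3 : (1 - X) * (1 + X) = (1 + X) * (1 - X) := by noncomm_ring
  rw [cayley, sympInv_mul, sympInv_add, sympInv_one, hX, ← sub_eq_add_neg]
  calc sympInv (1 - X)⁻¹ * (1 - X) * ((1 + X) * (1 - X)⁻¹)
      = sympInv (1 - X)⁻¹ * ((1 - X) * (1 + X)) * (1 - X)⁻¹ := by simp only [Matrix.mul_assoc]
    _ = (sympInv (1 - X)⁻¹ * (1 + X)) * ((1 - X) * (1 - X)⁻¹) := by
        rw [h3]; simp only [Matrix.mul_assoc]
    _ = 1 := by rw [h1, h2, Matrix.mul_one]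

theorem sympInv_cayley_inv {A : Mat n n} (hA : sympInv A * A = 1) (h : (A + 1).det ≠ 0) :
    sympInv ((A - 1) * (A + 1)⁻¹) = -((A - 1) * (A + 1)⁻¹) := by
  have h1 : (A + 1) * (A + 1)⁻¹ = 1 := Matrix.mul_nonsing_inv _ (isUnit_iff_ne_zero.2 h)
  have h2 : sympInv (A + 1)⁻¹ * (sympInv A + 1) = 1 := by
    have := congrArg sympInv h1
    rwa [sympInv_mul, sympInv_add, sympInv_one] at this
  -- Both sides equal `A⁺ - A`, since `A⁺A = 1`.
  have h3 : (sympInv A - 1) * (A + 1) = -((sympInv A + 1) * (A - 1)) := by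
    simp only [Matrix.sub_mul, Matrix.add_mul, Matrix.mul_sub, Matrix.mul_add, hA, Matrix.one_mul,
      Matrix.mul_one]
    abel
  rw [sympInv_mul, sympInv_sub, sympInv_one]
  calc sympInv (A + 1)⁻¹ * (sympInv A - 1)
      = sympInv (A + 1)⁻¹ * ((sympInv A - 1) * (A + 1)) * (A + 1)⁻¹ := by
        simp only [Matrix.mul_assoc, h1, Matrix.mul_one]
    _ = -((sympInv (A + 1)⁻¹ * (sympInv A + 1)) * (A - 1) * (A + 1)⁻¹) := by
        rw [h3]; simp only [Matrix.mul_assoc, Matrix.mul_neg, Matrix.neg_mul]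
    _ = _ := by rw [h2, Matrix.one_mul]

theorem SmoothMatAt.cayley {E : Type*} [NormedAddCommGroup E] [NormedSpace ℝ E] {x : E}
    {f : E → Mat n n} (hf : SmoothMatAt f x) (h : (1 - f x).det ≠ 0) :
    SmoothMatAt (fun y => cayley (f y)) x :=
  ((SmoothMatAt.const 1).add hf).mul (((SmoothMatAt.const 1).sub hf).inv h)

end Cayley

/-! ### The symplectic group as an embedded submanifold -/

section SpManifold

/-- Linear coordinates on the space of symmetric `2n × 2n` matrices. -/
noncomputable def symEquiv (n : ℕ) :
    EuclideanSpace ℝ (Fin ((2 * n + 1) * n)) ≃L[ℝ] (Sym2 (Fin n ⊕ Fin n) → ℝ) :=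
  ContinuousLinearEquiv.ofFinrankEq (by
    -- There are `(2n+1).choose 2 = (2n+1)n` unordered pairs, repetition allowed, of `2n` indices.
    rw [finrank_euclideanSpace_fin, Module.finrank_fintype_fun_eq_card, Sym2.card,
      Fintype.card_sum, Fintype.card_fin, Nat.choose_two_right, ← two_mul, Nat.add_sub_cancel,
      mul_left_comm, Nat.mul_div_cancel_left _ two_pos])

/-- The symmetric matrix with given coordinates. -/
noncomputable def symMat {n : ℕ} (e : EuclideanSpace ℝ (Fin ((2 * n + 1) * n))) : Mat n n :=
  Matrix.of fun i j => symEquiv n e s(i, j)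

/-- The coordinates of the symmetric part of a matrix. -/
noncomputable def symCoord {n : ℕ} (A : Mat n n) : EuclideanSpace ℝ (Fin ((2 * n + 1) * n)) :=
  (symEquiv n).symm (Sym2.lift ⟨fun i j => (A i j + A j i) / 2, fun i j => by
    change (A i j + A j i) / 2 = (A j i + A i j) / 2
    rw [add_comm]⟩)

theorem symMat_transpose {n : ℕ} (e : EuclideanSpace ℝ (Fin ((2 * n + 1) * n))) :
    (symMat e)ᵀ = symMat e := by
  ext i j; simp [symMat, Sym2.eq_swap]

theorem symCoord_symMat {n : ℕ} (e : EuclideanSpace ℝ (Fin ((2 * n + 1) * n))) :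
    symCoord (symMat e) = e := by
  rw [symCoord, ContinuousLinearEquiv.symm_apply_eq]
  ext z
  induction z with | _ i j => simp [symMat, Sym2.eq_swap (a := j) (b := i)]

theorem symMat_symCoord {n : ℕ} {A : Mat n n} (hA : Aᵀ = A) : symMat (symCoord A) = A := by
  ext i j
  have h : A j i = A i j := congrFun (congrFun hA i) j
  simp [symMat, symCoord, h]

theorem smoothMatAt_symMat {n : ℕ} (e : EuclideanSpace ℝ (Fin ((2 * n + 1) * n))) :
    SmoothMatAt (symMat (n := n)) e :=
  fun i j => contDiffAt_pi.1 (symEquiv n).contDiff.contDiffAt s(i, j)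

theorem SmoothMatAt.symCoord {n : ℕ} {E : Type*} [NormedAddCommGroup E] [NormedSpace ℝ E] {x : E}
    {f : E → Mat n n} (hf : SmoothMatAt f x) : ContDiffAt ℝ ∞ (fun y => symCoord (f y)) x := by
  refine (symEquiv n).symm.contDiff.contDiffAt.comp x (contDiffAt_pi.2 fun z => ?_)
  induction z with | _ i j => exact ((hf i j).add (hf j i)).div_const 2

/-- The space `ℝ^{2n × 2n}` with its structure of a product. -/
abbrev MatFun (n : ℕ) : Type := Fin n ⊕ Fin n → Fin n ⊕ Fin n → ℝ

theorem smoothMatAt_of {n : ℕ} (A : MatFun n) :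
    SmoothMatAt (fun A : MatFun n => (Matrix.of A : Mat n n)) A :=
  ContDiffAt.smoothMatAt contDiffAt_id

/-- With `transpose_neg_stdJ_mul`, this identifies the Lie algebra with the symmetric matrices
through `X = JS`, `S = -JX`. -/
theorem sympInv_stdJ_mul {n : ℕ} {S : Mat n n} (hS : Sᵀ = S) :
    sympInv (stdJ n * S) = -(stdJ n * S) := by
  simp [sympInv, hS, stdJ_transpose, Matrix.mul_assoc, stdJ_mul_stdJ]

theorem transpose_neg_stdJ_mul {n : ℕ} {X : Mat n n} (hX : sympInv X = -X) :
    (-(stdJ n * X))ᵀ = -(stdJ n * X) := by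
  have h : stdJ n * sympInv X = Xᵀ * stdJ n := by
    simp [sympInv, stdJ_transpose, Matrix.mul_assoc, stdJ_mul_cancel]
  rw [hX, Matrix.mul_neg] at h
  rw [h, Matrix.transpose_mul, Matrix.transpose_transpose, stdJ_transpose, Matrix.neg_mul, h]

/-- The inclusion of `Sp(2n)` into `ℝ^{2n × 2n}`. -/
def spIncl (n : ℕ) (M : Sp n) : MatFun n := fun i j => (M : Mat n n) i j

theorem isEmbedding_spIncl (n : ℕ) : Topology.IsEmbedding (spIncl n) :=
  Topology.IsEmbedding.subtypeVal

/-- The Cayley parametrization of `Sp(2n)` near `g`. -/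
noncomputable def spParam {n : ℕ} (g : Sp n) :
    LocalParam (EuclideanSpace ℝ (Fin ((2 * n + 1) * n))) (spIncl n) g where
  -- Translate `g` to the identity by `g⁺ = g⁻¹`, apply the inverse Cayley transform to get `X`, and
  -- take the coordinates of `S = -JX`.
  φ A := symCoord (-(stdJ n * ((sympInv (g : Mat n n) * Matrix.of A - 1) *
    (sympInv (g : Mat n n) * Matrix.of A + 1)⁻¹)))
  ψ e := (g : Mat n n) * cayley (stdJ n * symMat e)
  source := {A | (sympInv (g : Mat n n) * Matrix.of A + 1).det ≠ 0}
  target := {e | (1 - stdJ n * symMat e).det ≠ 0}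
  isOpen_source := isOpen_det_ne_zero fun A =>
    ((SmoothMatAt.const _).mul (smoothMatAt_of A)).add (SmoothMatAt.const _)
  isOpen_target := isOpen_det_ne_zero fun e =>
    (SmoothMatAt.const _).sub ((SmoothMatAt.const _).mul (smoothMatAt_symMat e))
  mem_source := by
    change (sympInv (g : Mat n n) * (g : Mat n n) + 1).det ≠ 0
    rw [sympInv_mul_self, ← two_smul ℝ (1 : Mat n n), Matrix.det_smul]
    simp
  contDiffOn_φ A hA := by
    have h1 := (SmoothMatAt.const (sympInv (g : Mat n n))).mul (smoothMatAt_of A)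
    have h2 := (h1.sub (SmoothMatAt.const 1)).mul ((h1.add (SmoothMatAt.const 1)).inv hA)
    have h3 := (SmoothMatAt.const (-stdJ n)).mul h2
    simp only [Matrix.neg_mul] at h3
    exact h3.symCoord.contDiffWithinAt
  contDiffOn_ψ e he := by
    have h1 := (SmoothMatAt.const (stdJ n)).mul (smoothMatAt_symMat e)
    exact ((SmoothMatAt.const _).mul (h1.cayley he)).contDiffAt.contDiffWithinAt
  ψ_mem_range e he := by
    have h := sympInv_cayley_mul (sympInv_stdJ_mul (symMat_transpose e)) he
    exact ⟨g * ⟨_, (mem_symplecticGroup_iff _).2 h⟩, rfl⟩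
  ψ_mem_source e he := by
    change (sympInv (g : Mat n n) * ((g : Mat n n) * cayley (stdJ n * symMat e)) + 1).det ≠ 0
    rw [← Matrix.mul_assoc, sympInv_mul_self, Matrix.one_mul]
    exact det_cayley_add_one_ne_zero he
  φ_ψ e he := by
    change symCoord (-(stdJ n * ((sympInv (g : Mat n n) * ((g : Mat n n) *
      cayley (stdJ n * symMat e)) - 1) * (sympInv (g : Mat n n) * ((g : Mat n n) *
      cayley (stdJ n * symMat e)) + 1)⁻¹))) = e
    rw [← Matrix.mul_assoc (sympInv (g : Mat n n)), sympInv_mul_self, Matrix.one_mul,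
      cayley_sub_one_mul_inv he,
      stdJ_mul_cancel, neg_neg, symCoord_symMat]
  φ_mem_target M hM := by
    have h1 : sympInv (sympInv (g : Mat n n) * (M : Mat n n)) *
      (sympInv (g : Mat n n) * (M : Mat n n)) = 1 := by
      rw [sympInv_mul, sympInv_sympInv, Matrix.mul_assoc, ← Matrix.mul_assoc (g : Mat n n),
        mul_sympInv_self, Matrix.one_mul, sympInv_mul_self]
    have hM' : (sympInv (g : Mat n n) * (M : Mat n n) + 1).det ≠ 0 := hM
    have h2 := sympInv_cayley_inv h1 hM'
    change (1 - stdJ n * symMat (symCoord (-(stdJ n * ((sympInv (g : Mat n n) * (M : Mat n n) - 1) *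
      (sympInv (g : Mat n n) * (M : Mat n n) + 1)⁻¹))))).det ≠ 0
    rw [symMat_symCoord (transpose_neg_stdJ_mul h2), Matrix.mul_neg, stdJ_mul_cancel, neg_neg,
      one_sub_cayley_inv hM']
    exact det_two_smul_inv_ne_zero hM'
  ψ_φ M hM := by
    have h1 : sympInv (sympInv (g : Mat n n) * (M : Mat n n)) *
      (sympInv (g : Mat n n) * (M : Mat n n)) = 1 := by
      rw [sympInv_mul, sympInv_sympInv, Matrix.mul_assoc, ← Matrix.mul_assoc (g : Mat n n),
        mul_sympInv_self, Matrix.one_mul, sympInv_mul_self]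
    have hM' : (sympInv (g : Mat n n) * (M : Mat n n) + 1).det ≠ 0 := hM
    have h2 := sympInv_cayley_inv h1 hM'
    change (g : Mat n n) * cayley (stdJ n * symMat (symCoord (-(stdJ n *
      ((sympInv (g : Mat n n) * (M : Mat n n) - 1) *
      (sympInv (g : Mat n n) * (M : Mat n n) + 1)⁻¹))))) = (M : Mat n n)
    rw [symMat_symCoord (transpose_neg_stdJ_mul h2), Matrix.mul_neg, stdJ_mul_cancel, neg_neg,
      cayley_cayley_inv hM', ← Matrix.mul_assoc, mul_sympInv_self, Matrix.one_mul]

end SpManifold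

/-! ### Graph coordinates on the Grassmannian -/

section Graph

variable {n k : ℕ}

theorem conj_mem_SpGr {P : Mat n n} (hP : P ∈ SpGr n k) (M : Sp n) :
    (M : Mat n n) * P * sympInv (M : Mat n n) ∈ SpGr n k := by
  obtain ⟨U, hU, rfl⟩ := exists_eq_mul_sympInv hP
  have h : (M : Mat n n) * U ∈ SpSt n k := by
    change sympInv ((M : Mat n n) * U) * ((M : Mat n n) * U) = 1
    rw [sympInv_mul, Matrix.mul_assoc, ← Matrix.mul_assoc (sympInv (M : Mat n n)),
      sympInv_mul_self, Matrix.one_mul]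
    exact hU
  have h' := mem_SpGr_of_mem_SpSt h
  rwa [sympInv_mul, ← Matrix.mul_assoc, Matrix.mul_assoc (M : Mat n n) U] at h'

theorem E₀_mem_SpGr (hk : k ≤ n) : E₀ n k ∈ SpGr n k :=
  mem_SpGr_of_mem_SpSt (sympInv_stdE_mul hk : sympInv (stdE n k) * stdE n k = 1)

/-- A frame of the graph of `B`. -/
noncomputable def graphFrame (hk : k ≤ n) (B : Mat (n - k) k) : Mat n k := stdE n k + coE hk * B

/-- The symplectic projection onto the graph of `B`. -/
noncomputable def graphProj (hk : k ≤ n) (B : Mat (n - k) k) : Mat n n :=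
  graphFrame hk B * (1 + sympInv B * B)⁻¹ * sympInv (graphFrame hk B)

/-- The matrix of which the range of a projection is the graph. -/
noncomputable def graphCoord (hk : k ≤ n) (Q : Mat n n) : Mat (n - k) k :=
  sympInv (coE hk) * Q * stdE n k * (sympInv (stdE n k) * Q * stdE n k)⁻¹

theorem sympInv_stdE_mul_graphFrame (hk : k ≤ n) (B : Mat (n - k) k) :
    sympInv (stdE n k) * graphFrame hk B = 1 := by
  rw [graphFrame, Matrix.mul_add, sympInv_stdE_mul hk, ← Matrix.mul_assoc, sympInv_stdE_mul_coE,
    Matrix.zero_mul, add_zero]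

theorem sympInv_coE_mul_graphFrame (hk : k ≤ n) (B : Mat (n - k) k) :
    sympInv (coE hk) * graphFrame hk B = B := by
  rw [graphFrame, Matrix.mul_add, sympInv_coE_mul_stdE hk, ← Matrix.mul_assoc, sympInv_coE_mul,
    Matrix.one_mul, zero_add]

theorem sympInv_graphFrame_mul_stdE (hk : k ≤ n) (B : Mat (n - k) k) :
    sympInv (graphFrame hk B) * stdE n k = 1 := by
  have h := congrArg sympInv (sympInv_stdE_mul_graphFrame hk B)
  rwa [sympInv_mul, sympInv_sympInv, sympInv_one] at h

/-- The graph of `B` is symplectic exactly when this matrix is invertible, which explains the target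
of `grParam`. -/
theorem sympInv_graphFrame_mul (hk : k ≤ n) (B : Mat (n - k) k) :
    sympInv (graphFrame hk B) * graphFrame hk B = 1 + sympInv B * B := by
  have h : sympInv (graphFrame hk B) = sympInv (stdE n k) + sympInv B * sympInv (coE hk) := by
    rw [graphFrame, sympInv_add, sympInv_mul]
  rw [h, Matrix.add_mul, sympInv_stdE_mul_graphFrame, Matrix.mul_assoc,
    sympInv_coE_mul_graphFrame]

theorem sympInv_stdE_mul_graphProj (hk : k ≤ n) (B : Mat (n - k) k) :
    sympInv (stdE n k) * graphProj hk B * stdE n k = (1 + sympInv B * B)⁻¹ := by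
  calc sympInv (stdE n k) * graphProj hk B * stdE n k
      = (sympInv (stdE n k) * graphFrame hk B) * (1 + sympInv B * B)⁻¹ *
        (sympInv (graphFrame hk B) * stdE n k) := by simp only [graphProj, Matrix.mul_assoc]
    _ = _ := by rw [sympInv_stdE_mul_graphFrame, sympInv_graphFrame_mul_stdE, Matrix.one_mul,
        Matrix.mul_one]

theorem sympInv_coE_mul_graphProj (hk : k ≤ n) (B : Mat (n - k) k) :
    sympInv (coE hk) * graphProj hk B * stdE n k = B * (1 + sympInv B * B)⁻¹ := by
  calc sympInv (coE hk) * graphProj hk B * stdE n k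
      = (sympInv (coE hk) * graphFrame hk B) * (1 + sympInv B * B)⁻¹ *
        (sympInv (graphFrame hk B) * stdE n k) := by simp only [graphProj, Matrix.mul_assoc]
    _ = _ := by rw [sympInv_coE_mul_graphFrame, sympInv_graphFrame_mul_stdE, Matrix.mul_one]

theorem det_inv_ne_zero {m : Type*} [Fintype m] [DecidableEq m] {A : Matrix m m ℝ}
    (h : A.det ≠ 0) : A⁻¹.det ≠ 0 :=
  (Matrix.isUnit_nonsing_inv_det _ (isUnit_iff_ne_zero.2 h)).ne_zero

theorem graphCoord_graphProj (hk : k ≤ n) {B : Mat (n - k) k} (h : (1 + sympInv B * B).det ≠ 0) :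
    graphCoord hk (graphProj hk B) = B := by
  rw [graphCoord, sympInv_coE_mul_graphProj, sympInv_stdE_mul_graphProj,
    Matrix.mul_nonsing_inv_cancel_right _ _ (isUnit_iff_ne_zero.2 (det_inv_ne_zero h))]

theorem graphProj_mem_SpGr (hk : k ≤ n) {B : Mat (n - k) k} (h : (1 + sympInv B * B).det ≠ 0) :
    graphProj hk B ∈ SpGr n k := by
  have hu := isUnit_iff_ne_zero.2 h
  refine ⟨?_, le_antisymm ?_ ?_, ?_⟩
  · calc graphProj hk B ^ 2 = graphFrame hk B * ((1 + sympInv B * B)⁻¹ *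
          (sympInv (graphFrame hk B) * graphFrame hk B)) * (1 + sympInv B * B)⁻¹ *
          sympInv (graphFrame hk B) := by simp only [sq, graphProj, Matrix.mul_assoc]
      _ = _ := by
        rw [sympInv_graphFrame_mul, Matrix.nonsing_inv_mul _ hu, Matrix.mul_one, graphProj]
  · refine (Matrix.rank_mul_le_right _ _).trans ((Matrix.rank_le_card_height _).trans_eq ?_)
    simp [two_mul]
  · calc 2 * k = ((1 + sympInv B * B)⁻¹).rank := by
          rw [Matrix.rank_of_isUnit _ ((Matrix.isUnit_iff_isUnit_det _).2
            (isUnit_iff_ne_zero.2 (det_inv_ne_zero h)))]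
          simp [two_mul]
      _ ≤ (sympInv (stdE n k) * graphProj hk B).rank := by
          rw [← sympInv_stdE_mul_graphProj hk]
          exact Matrix.rank_mul_le_left _ _
      _ ≤ _ := Matrix.rank_mul_le_right _ _
  · rw [graphProj, sympInv_mul, sympInv_mul, sympInv_sympInv, sympInv_inv, sympInv_add,
      sympInv_mul, sympInv_sympInv, sympInv_one, Matrix.mul_assoc]

/-- The right side is the frame `QE` of the range of `Q`, normalized so that its `stdE` component is
the identity. -/
theorem graphFrame_graphCoord (hk : k ≤ n) {Q : Mat n n}
    (h : (sympInv (stdE n k) * Q * stdE n k).det ≠ 0) :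
    graphFrame hk (graphCoord hk Q) = Q * stdE n k * (sympInv (stdE n k) * Q * stdE n k)⁻¹ := by
  have h1 := Matrix.mul_nonsing_inv _ (isUnit_iff_ne_zero.2 h)
  calc graphFrame hk (graphCoord hk Q)
      = stdE n k * ((sympInv (stdE n k) * Q * stdE n k) *
          (sympInv (stdE n k) * Q * stdE n k)⁻¹) + coE hk * graphCoord hk Q := by
        rw [h1, Matrix.mul_one, graphFrame]
    _ = (stdE n k * sympInv (stdE n k) + coE hk * sympInv (coE hk)) * (Q * stdE n k) *
          (sympInv (stdE n k) * Q * stdE n k)⁻¹ := by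
        simp only [graphCoord, Matrix.add_mul, Matrix.mul_assoc]
    _ = _ := by rw [stdE_mul_add, Matrix.one_mul]

theorem one_add_graphCoord (hk : k ≤ n) {Q : Mat n n} (hQ : Q ∈ SpGr n k)
    (h : (sympInv (stdE n k) * Q * stdE n k).det ≠ 0) :
    1 + sympInv (graphCoord hk Q) * graphCoord hk Q =
      (sympInv (stdE n k) * Q * stdE n k)⁻¹ := by
  have h1 := Matrix.mul_nonsing_inv _ (isUnit_iff_ne_zero.2 h)
  have hs : sympInv (sympInv (stdE n k) * Q * stdE n k) = sympInv (stdE n k) * Q * stdE n k := by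
    simp only [sympInv_mul, sympInv_sympInv, hQ.2.2, Matrix.mul_assoc]
  have hQ2 : Q * Q = Q := by rw [← sq, hQ.1]
  rw [← sympInv_graphFrame_mul hk, graphFrame_graphCoord hk h]
  rw [sympInv_mul, sympInv_inv, hs, sympInv_mul, hQ.2.2]
  calc _ = (sympInv (stdE n k) * Q * stdE n k)⁻¹ * ((sympInv (stdE n k) * (Q * Q) * stdE n k) *
        (sympInv (stdE n k) * Q * stdE n k)⁻¹) := by simp only [Matrix.mul_assoc]
    _ = _ := by rw [hQ2, h1, Matrix.mul_one]

theorem graphProj_graphCoord (hk : k ≤ n) {Q : Mat n n} (hQ : Q ∈ SpGr n k)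
    (h : (sympInv (stdE n k) * Q * stdE n k).det ≠ 0) :
    graphProj hk (graphCoord hk Q) = Q := by
  rw [graphProj, one_add_graphCoord hk hQ h, Matrix.nonsing_inv_nonsing_inv _
    (isUnit_iff_ne_zero.2 h), graphFrame_graphCoord hk h]
  -- With `Q = UU⁺`, `a = E⁺U` and `b = U⁺E = a⁺`, the frame is `Ua⁻¹`, and the projection becomes
  -- `Ua⁻¹ (ab) b⁻¹U⁺ = UU⁺`.
  obtain ⟨U, hU, rfl⟩ := exists_eq_mul_sympInv hQ
  replace hU : sympInv U * U = 1 := hU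
  have e1 : sympInv (stdE n k) * (U * sympInv U) * stdE n k =
      (sympInv (stdE n k) * U) * (sympInv U * stdE n k) := by simp only [Matrix.mul_assoc]
  rw [e1] at h ⊢
  rw [Matrix.det_mul] at h
  have ha := isUnit_iff_ne_zero.2 (left_ne_zero_of_mul h)
  have hb := isUnit_iff_ne_zero.2 (right_ne_zero_of_mul h)
  set a := sympInv (stdE n k) * U with ha'
  set b := sympInv U * stdE n k with hb'
  have hab : sympInv b = a := by rw [hb', sympInv_mul, sympInv_sympInv]
  have hba : sympInv a = b := by rw [← hab, sympInv_sympInv]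
  have e2 : U * sympInv U * stdE n k * (a * b)⁻¹ = U * a⁻¹ := by
    rw [Matrix.mul_inv_rev, Matrix.mul_assoc U, ← hb', Matrix.mul_assoc,
      Matrix.mul_nonsing_inv_cancel_left _ _ hb]
  rw [e2, sympInv_mul, sympInv_inv, hba, ← Matrix.mul_assoc, Matrix.mul_assoc U,
    Matrix.nonsing_inv_mul_cancel_left _ _ ha, Matrix.mul_assoc U,
    Matrix.mul_nonsing_inv _ hb, Matrix.mul_one]

end Graph

/-! ### The Grassmannian as an embedded submanifold -/

section GrManifold

variable {n k : ℕ}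

/-- Linear coordinates on the space of `2(n - k) × 2k` matrices. -/
noncomputable def blockEquiv (n k : ℕ) : EuclideanSpace ℝ (Fin (4 * (n - k) * k)) ≃L[ℝ]
    (Fin (n - k) ⊕ Fin (n - k) → Fin k ⊕ Fin k → ℝ) :=
  ContinuousLinearEquiv.ofFinrankEq (by
    rw [finrank_euclideanSpace_fin, Module.finrank_pi_fintype]
    simp
    ring)

/-- The matrix with given coordinates. -/
noncomputable def blockOf (e : EuclideanSpace ℝ (Fin (4 * (n - k) * k))) : Mat (n - k) k :=
  Matrix.of (blockEquiv n k e)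

/-- The coordinates of a matrix. -/
noncomputable def blockCoord (B : Mat (n - k) k) : EuclideanSpace ℝ (Fin (4 * (n - k) * k)) :=
  (blockEquiv n k).symm fun i j => B i j

@[simp] theorem blockCoord_blockOf (e : EuclideanSpace ℝ (Fin (4 * (n - k) * k))) :
    blockCoord (blockOf e) = e :=
  (blockEquiv n k).symm_apply_apply e

@[simp] theorem blockOf_blockCoord (B : Mat (n - k) k) : blockOf (blockCoord B) = B :=
  (blockEquiv n k).apply_symm_apply _

theorem blockOf_smul (t : ℝ) (e : EuclideanSpace ℝ (Fin (4 * (n - k) * k))) :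
    blockOf (t • e) = t • blockOf e :=
  (blockEquiv n k).map_smul t e

theorem blockOf_zero : blockOf (0 : EuclideanSpace ℝ (Fin (4 * (n - k) * k))) = 0 :=
  (blockEquiv n k).map_zero

theorem blockCoord_smul (t : ℝ) (B : Mat (n - k) k) : blockCoord (t • B) = t • blockCoord B :=
  (blockEquiv n k).symm.map_smul t _

theorem smoothMatAt_blockOf (e : EuclideanSpace ℝ (Fin (4 * (n - k) * k))) :
    SmoothMatAt (blockOf (n := n) (k := k)) e :=
  ContDiffAt.smoothMatAt (blockEquiv n k).contDiff.contDiffAt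

theorem SmoothMatAt.blockCoord {E : Type*} [NormedAddCommGroup E] [NormedSpace ℝ E] {x : E}
    {f : E → Mat (n - k) k} (hf : SmoothMatAt f x) :
    ContDiffAt ℝ ∞ (fun y => blockCoord (f y)) x :=
  (blockEquiv n k).symm.contDiff.contDiffAt.comp x hf.contDiffAt

theorem smoothMatAt_graphCoord (hk : k ≤ n) {E : Type*} [NormedAddCommGroup E] [NormedSpace ℝ E]
    {x : E} {f : E → Mat n n} (hf : SmoothMatAt f x)
    (h : (sympInv (stdE n k) * f x * stdE n k).det ≠ 0) :
    SmoothMatAt (fun y => graphCoord hk (f y)) x :=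
  (((SmoothMatAt.const _).mul hf).mul (SmoothMatAt.const _)).mul
    ((((SmoothMatAt.const _).mul hf).mul (SmoothMatAt.const _)).inv h)

theorem smoothMatAt_graphProj (hk : k ≤ n) {E : Type*} [NormedAddCommGroup E] [NormedSpace ℝ E]
    {x : E} {f : E → Mat (n - k) k} (hf : SmoothMatAt f x)
    (h : (1 + sympInv (f x) * f x).det ≠ 0) :
    SmoothMatAt (fun y => graphProj hk (f y)) x := by
  have h1 : SmoothMatAt (fun y => graphFrame hk (f y)) x :=
    (SmoothMatAt.const _).add ((SmoothMatAt.const _).mul hf)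
  exact (h1.mul (((SmoothMatAt.const _).add (hf.sympInv.mul hf)).inv h)).mul h1.sympInv

/-- Conjugation `Q ↦ M⁺ Q M` by a symplectic matrix. -/
noncomputable def conjBack (M : Sp n) (Q : Mat n n) : Mat n n :=
  sympInv (M : Mat n n) * Q * (M : Mat n n)

theorem conjBack_conj (M : Sp n) (Q : Mat n n) :
    conjBack M ((M : Mat n n) * Q * sympInv (M : Mat n n)) = Q := by
  calc conjBack M ((M : Mat n n) * Q * sympInv (M : Mat n n))
      = (sympInv (M : Mat n n) * (M : Mat n n)) * Q * (sympInv (M : Mat n n) * (M : Mat n n)) := by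
        simp only [conjBack, Matrix.mul_assoc]
    _ = Q := by rw [sympInv_mul_self, Matrix.one_mul, Matrix.mul_one]

theorem conj_conjBack (M : Sp n) (Q : Mat n n) :
    (M : Mat n n) * conjBack M Q * sympInv (M : Mat n n) = Q := by
  calc (M : Mat n n) * conjBack M Q * sympInv (M : Mat n n)
      = ((M : Mat n n) * sympInv (M : Mat n n)) * Q * ((M : Mat n n) * sympInv (M : Mat n n)) := by
        simp only [conjBack, Matrix.mul_assoc]
    _ = Q := by rw [mul_sympInv_self, Matrix.one_mul, Matrix.mul_one]

theorem conjBack_mem_SpGr {Q : Mat n n} (hQ : Q ∈ SpGr n k) (M : Sp n) :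
    conjBack M Q ∈ SpGr n k := by
  have h := conj_mem_SpGr hQ M⁻¹
  rwa [coe_inv_eq_sympInv, sympInv_sympInv] at h

theorem SmoothMatAt.conjBack (M : Sp n) {E : Type*} [NormedAddCommGroup E] [NormedSpace ℝ E]
    {x : E} {f : E → Mat n n} (hf : SmoothMatAt f x) : SmoothMatAt (fun y => conjBack M (f y)) x :=
  ((SmoothMatAt.const _).mul hf).mul (SmoothMatAt.const _)

/-- The inclusion of the Grassmannian into `ℝ^{2n × 2n}`. -/
def grIncl (n k : ℕ) (P : SpGr n k) : MatFun n := fun i j => (P : Mat n n) i j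

theorem isEmbedding_grIncl (n k : ℕ) : Topology.IsEmbedding (grIncl n k) :=
  Topology.IsEmbedding.subtypeVal

theorem sympInv_stdE_mul_E₀ (hk : k ≤ n) : sympInv (stdE n k) * E₀ n k * stdE n k = 1 := by
  rw [E₀, ← Matrix.mul_assoc, sympInv_stdE_mul hk, Matrix.one_mul, sympInv_stdE_mul hk]

/-- The chart domain around the image of `E₀` under `M`. -/
def grSource (k : ℕ) (M : Sp n) : Set (MatFun n) :=
  {Q | (sympInv (stdE n k) * conjBack M (Matrix.of Q) * stdE n k).det ≠ 0}

/-- The chart around the image of `E₀` under `M`. -/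
noncomputable def grCoord (hk : k ≤ n) (M : Sp n) (Q : MatFun n) :
    EuclideanSpace ℝ (Fin (4 * (n - k) * k)) :=
  blockCoord (graphCoord hk (conjBack M (Matrix.of Q)))

theorem isOpen_grSource (M : Sp n) : IsOpen (grSource k M) :=
  isOpen_det_ne_zero fun A =>
    ((SmoothMatAt.const _).mul ((smoothMatAt_of A).conjBack M)).mul (SmoothMatAt.const _)

theorem contDiffAt_grCoord (hk : k ≤ n) (M : Sp n) {Q : MatFun n} (hQ : Q ∈ grSource k M) :
    ContDiffAt ℝ ∞ (grCoord hk M) Q :=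
  (smoothMatAt_graphCoord hk ((smoothMatAt_of Q).conjBack M) hQ).blockCoord

/-- The graph parametrization of the Grassmannian near the image of `E₀` under `M`. -/
noncomputable def grParam (hk : k ≤ n) (M : Sp n) {P : SpGr n k}
    (hP : (M : Mat n n) * E₀ n k * sympInv (M : Mat n n) = P) :
    LocalParam (EuclideanSpace ℝ (Fin (4 * (n - k) * k))) (grIncl n k) P where
  φ := grCoord hk M
  ψ e := (M : Mat n n) * graphProj hk (blockOf e) * sympInv (M : Mat n n)
  source := grSource k M
  target := {e | ((1 : Mat k k) + sympInv (blockOf e) * blockOf e).det ≠ 0}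
  isOpen_source := isOpen_grSource M
  isOpen_target := isOpen_det_ne_zero fun e =>
    (SmoothMatAt.const _).add ((smoothMatAt_blockOf e).sympInv.mul (smoothMatAt_blockOf e))
  mem_source := by
    change (sympInv (stdE n k) * conjBack M (P : Mat n n) * stdE n k).det ≠ 0
    rw [← hP, conjBack_conj, sympInv_stdE_mul_E₀ hk]
    simp
  contDiffOn_φ Q hQ := (contDiffAt_grCoord hk M hQ).contDiffWithinAt
  contDiffOn_ψ e he :=
    (((SmoothMatAt.const _).mul (smoothMatAt_graphProj hk (smoothMatAt_blockOf e) he)).mul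
      (SmoothMatAt.const _)).contDiffAt.contDiffWithinAt
  ψ_mem_range e he := ⟨⟨_, conj_mem_SpGr (graphProj_mem_SpGr hk he) M⟩, rfl⟩
  ψ_mem_source e he := by
    change (sympInv (stdE n k) * conjBack M ((M : Mat n n) * graphProj hk (blockOf e) *
      sympInv (M : Mat n n)) * stdE n k).det ≠ 0
    rw [conjBack_conj, sympInv_stdE_mul_graphProj]
    exact det_inv_ne_zero he
  φ_ψ e he := by
    change blockCoord (graphCoord hk (conjBack M ((M : Mat n n) * graphProj hk (blockOf e) *
      sympInv (M : Mat n n)))) = e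
    rw [conjBack_conj, graphCoord_graphProj hk he, blockCoord_blockOf]
  φ_mem_target Q hQ := by
    change (1 + sympInv (blockOf (blockCoord (graphCoord hk (conjBack M (Q : Mat n n))))) *
      blockOf (blockCoord (graphCoord hk (conjBack M (Q : Mat n n))))).det ≠ 0
    rw [blockOf_blockCoord, one_add_graphCoord hk (conjBack_mem_SpGr Q.2 M) hQ]
    exact det_inv_ne_zero hQ
  ψ_φ Q hQ := by
    change (M : Mat n n) * graphProj hk (blockOf (blockCoord (graphCoord hk
      (conjBack M (Q : Mat n n))))) * sympInv (M : Mat n n) = (Q : Mat n n)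
    rw [blockOf_blockCoord, graphProj_graphCoord hk (conjBack_mem_SpGr Q.2 M) hQ, conj_conjBack]

end GrManifold

/-! ### The orbit map -/

section Orbit

open Topology Filter

variable {n k : ℕ}

/-- The orbit map `M ↦ M E₀ M⁺` onto the Grassmannian. -/
noncomputable def orbitMap (hk : k ≤ n) (M : Sp n) : SpGr n k :=
  ⟨(M : Mat n n) * E₀ n k * sympInv (M : Mat n n), conj_mem_SpGr (E₀_mem_SpGr hk) M⟩

theorem orbitMap_surjective (hk : k ≤ n) : Function.Surjective (orbitMap hk) := fun P => by
  obtain ⟨M, hM⟩ := exists_smul_E₀_eq hk P.2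
  exact ⟨M, Subtype.ext hM⟩

/-- The element of the symplectic Lie algebra with off-diagonal blocks `B` and `-B⁺`. -/
noncomputable def offDiag (hk : k ≤ n) (B : Mat (n - k) k) : Mat n n :=
  coE hk * B * sympInv (stdE n k) - stdE n k * sympInv B * sympInv (coE hk)

theorem sympInv_offDiag (hk : k ≤ n) (B : Mat (n - k) k) :
    sympInv (offDiag hk B) = -offDiag hk B := by
  simp only [offDiag, sympInv_sub, sympInv_mul, sympInv_sympInv, Matrix.mul_assoc, neg_sub]

theorem sympInv_stdE_mul_offDiag (hk : k ≤ n) (B : Mat (n - k) k) :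
    sympInv (stdE n k) * offDiag hk B = -(sympInv B * sympInv (coE hk)) := by
  rw [offDiag, Matrix.mul_sub, Matrix.mul_assoc (coE hk), ← Matrix.mul_assoc, sympInv_stdE_mul_coE,
    Matrix.zero_mul, Matrix.mul_assoc (stdE n k), ← Matrix.mul_assoc, sympInv_stdE_mul hk,
    Matrix.one_mul, zero_sub]

theorem sympInv_coE_mul_offDiag (hk : k ≤ n) (B : Mat (n - k) k) :
    sympInv (coE hk) * offDiag hk B = B * sympInv (stdE n k) := by
  rw [offDiag, Matrix.mul_sub, Matrix.mul_assoc (coE hk), ← Matrix.mul_assoc, sympInv_coE_mul,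
    Matrix.one_mul, Matrix.mul_assoc (stdE n k), ← Matrix.mul_assoc, sympInv_coE_mul_stdE hk,
    Matrix.zero_mul, sub_zero]

/-- As `cE₀c⁺ = (cE)(cE)⁺`, both blocks entering `graphCoord` carry the same right factor `(E⁺cE)⁺`,
which cancels. -/
theorem graphCoord_conj_of_blocks (hk : k ≤ n) {c : Mat n n}
    (ha : (sympInv (stdE n k) * c * stdE n k).det ≠ 0) :
    (sympInv (stdE n k) * (c * E₀ n k * sympInv c) * stdE n k).det ≠ 0 ∧
    graphCoord hk (c * E₀ n k * sympInv c) = sympInv (coE hk) * c * stdE n k *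
      (sympInv (stdE n k) * c * stdE n k)⁻¹ := by
  have e1 : ∀ {l : ℕ} (F : Mat l n), F * (c * E₀ n k * sympInv c) * stdE n k =
      F * c * stdE n k * sympInv (sympInv (stdE n k) * c * stdE n k) := by
    intro l F
    simp only [E₀, sympInv_mul, sympInv_sympInv, Matrix.mul_assoc]
  have ha' : (sympInv (sympInv (stdE n k) * c * stdE n k)).det ≠ 0 := by
    have h := congrArg sympInv (Matrix.mul_nonsing_inv _ (isUnit_iff_ne_zero.2 ha))
    rw [sympInv_mul, sympInv_one] at h
    exact (Matrix.isUnit_det_of_left_inverse h).ne_zero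
  constructor
  · rw [e1, Matrix.det_mul]
    exact mul_ne_zero ha ha'
  · rw [graphCoord, e1, e1, Matrix.mul_inv_rev, ← Matrix.mul_assoc,
      Matrix.mul_nonsing_inv_cancel_right _ _ (isUnit_iff_ne_zero.2 ha')]

/-- A matrix form of `tan 2θ = 2t / (1 - t²)`. Writing the Cayley transform as `2D - 1`, the
equation `(1 - X)D = 1` gives the blocks `p = (1 + B⁺B)⁻¹` and `Bp` of `D`; those of the transform
are `(1 - B⁺B)p` and `2Bp`. -/
theorem blocks_cayley_offDiag (hk : k ≤ n) {B : Mat (n - k) k}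
    (h : (1 - offDiag hk B).det ≠ 0) (h' : (1 - sympInv B * B).det ≠ 0) :
    (sympInv (stdE n k) * cayley (offDiag hk B) * stdE n k).det ≠ 0 ∧
    sympInv (coE hk) * cayley (offDiag hk B) * stdE n k *
      (sympInv (stdE n k) * cayley (offDiag hk B) * stdE n k)⁻¹ =
      (2 : ℝ) • (B * (1 - sympInv B * B)⁻¹) := by
  set D := (1 - offDiag hk B)⁻¹ with hD
  set p := sympInv (stdE n k) * D * stdE n k with hp
  have hD1 : (1 - offDiag hk B) * D = 1 := Matrix.mul_nonsing_inv _ (isUnit_iff_ne_zero.2 h)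
  have hc : cayley (offDiag hk B) = (2 : ℝ) • D - 1 := eq_sub_of_add_eq (cayley_add_one h)
  have hq : sympInv (coE hk) * D * stdE n k = B * p := by
    have h1 : sympInv (coE hk) * ((1 - offDiag hk B) * D) * stdE n k = 0 := by
      rw [hD1, Matrix.mul_one, sympInv_coE_mul_stdE hk]
    rw [← Matrix.mul_assoc, Matrix.mul_sub, Matrix.mul_one, sympInv_coE_mul_offDiag,
      Matrix.sub_mul, Matrix.sub_mul, sub_eq_zero] at h1
    rw [h1, hp]
    simp only [Matrix.mul_assoc]
  have hp1 : (1 + sympInv B * B) * p = 1 := by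
    have h1 : sympInv (stdE n k) * ((1 - offDiag hk B) * D) * stdE n k = 1 := by
      rw [hD1, Matrix.mul_one, sympInv_stdE_mul hk]
    rw [← Matrix.mul_assoc, Matrix.mul_sub, Matrix.mul_one, sympInv_stdE_mul_offDiag,
      sub_neg_eq_add, Matrix.add_mul, Matrix.add_mul] at h1
    rw [Matrix.add_mul, Matrix.one_mul, Matrix.mul_assoc, ← hq, ← h1, hp]
    simp only [Matrix.mul_assoc]
  have hpu := Matrix.isUnit_det_of_left_inverse hp1
  have ha : sympInv (stdE n k) * cayley (offDiag hk B) * stdE n k = (1 - sympInv B * B) * p := by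
    rw [hc, Matrix.mul_sub, Matrix.sub_mul, Matrix.mul_one, sympInv_stdE_mul hk, Matrix.mul_smul,
      Matrix.smul_mul, ← hp]
    calc (2 : ℝ) • p - 1 = (2 : ℝ) • p - (1 + sympInv B * B) * p := by rw [hp1]
      _ = _ := by rw [two_smul, Matrix.add_mul, Matrix.sub_mul, Matrix.one_mul]; abel
  have hb : sympInv (coE hk) * cayley (offDiag hk B) * stdE n k = (2 : ℝ) • (B * p) := by
    rw [hc, Matrix.mul_sub, Matrix.sub_mul, Matrix.mul_one, sympInv_coE_mul_stdE hk, sub_zero,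
      Matrix.mul_smul, Matrix.smul_mul, hq]
  rw [ha, hb]
  constructor
  · rw [Matrix.det_mul]
    exact mul_ne_zero h' hpu.ne_zero
  · rw [Matrix.mul_inv_rev, Matrix.smul_mul, ← Matrix.mul_assoc,
      Matrix.mul_nonsing_inv_cancel_right _ _ hpu]

open Classical in
/-- The curves `M · cayley(X)` in `Sp(2n)` transversal to the stabilizer. -/
noncomputable def cayleyShift (hk : k ≤ n) (M : Sp n)
    (e : EuclideanSpace ℝ (Fin (4 * (n - k) * k))) : Sp n :=
  if h : ((1 : Mat n n) - offDiag hk (blockOf e)).det ≠ 0 then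
    M * ⟨cayley (offDiag hk (blockOf e)),
      (mem_symplecticGroup_iff _).2 (sympInv_cayley_mul (sympInv_offDiag hk _) h)⟩
  -- A default value: only a neighbourhood of `e = 0`, where the determinant does not vanish, is
  -- used.
  else M

theorem coe_cayleyShift (hk : k ≤ n) (M : Sp n) {e : EuclideanSpace ℝ (Fin (4 * (n - k) * k))}
    (h : ((1 : Mat n n) - offDiag hk (blockOf e)).det ≠ 0) :
    (cayleyShift hk M e : Mat n n) = (M : Mat n n) * cayley (offDiag hk (blockOf e)) := by
  rw [cayleyShift, dif_pos h]; rfl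

/-- The expression of `orbitMap ∘ cayleyShift` in graph coordinates. -/
noncomputable def doubling (n k : ℕ) (e : EuclideanSpace ℝ (Fin (4 * (n - k) * k))) :
    EuclideanSpace ℝ (Fin (4 * (n - k) * k)) :=
  (2 : ℝ) • blockCoord (blockOf e * (1 - sympInv (blockOf e) * blockOf e : Mat k k)⁻¹)

theorem offDiag_zero (hk : k ≤ n) : offDiag hk (0 : Mat (n - k) k) = 0 := by
  simp [offDiag]

theorem smoothMatAt_offDiag (hk : k ≤ n) (e : EuclideanSpace ℝ (Fin (4 * (n - k) * k))) :
    SmoothMatAt (fun e => offDiag hk (blockOf e)) e :=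
  (((SmoothMatAt.const _).mul (smoothMatAt_blockOf e)).mul (SmoothMatAt.const _)).sub
    (((SmoothMatAt.const _).mul (smoothMatAt_blockOf e).sympInv).mul (SmoothMatAt.const _))

theorem eventually_det_ne_zero (hk : k ≤ n) :
    ∀ᶠ e in 𝓝 (0 : EuclideanSpace ℝ (Fin (4 * (n - k) * k))),
      ((1 : Mat n n) - offDiag hk (blockOf e)).det ≠ 0 := by
  refine (isOpen_det_ne_zero fun e => (SmoothMatAt.const (1 : Mat n n)).sub
    (smoothMatAt_offDiag hk e)).mem_nhds ?_
  simp [blockOf_zero, offDiag_zero]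

theorem smoothMatAt_one_sub (e : EuclideanSpace ℝ (Fin (4 * (n - k) * k))) :
    SmoothMatAt (fun e => (1 : Mat k k) - sympInv (blockOf (n := n) e) * blockOf (n := n) e) e :=
  (SmoothMatAt.const _).sub ((smoothMatAt_blockOf e).sympInv.mul (smoothMatAt_blockOf e))

theorem eventually_det_ne_zero' :
    ∀ᶠ e in 𝓝 (0 : EuclideanSpace ℝ (Fin (4 * (n - k) * k))),
      ((1 : Mat k k) - sympInv (blockOf (n := n) e) * blockOf (n := n) e).det ≠ 0 := by
  refine (isOpen_det_ne_zero fun e => smoothMatAt_one_sub e).mem_nhds ?_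
  simp [blockOf_zero]

/-- The local computation behind both openness of the orbit map and submersivity of the quotient
map. -/
theorem grCoord_orbitMap_cayleyShift (hk : k ≤ n) (M : Sp n) :
    ∀ᶠ e in 𝓝 (0 : EuclideanSpace ℝ (Fin (4 * (n - k) * k))),
      grIncl n k (orbitMap hk (cayleyShift hk M e)) ∈ grSource k M ∧
      grCoord hk M (grIncl n k (orbitMap hk (cayleyShift hk M e))) = doubling n k e := by
  filter_upwards [eventually_det_ne_zero hk, eventually_det_ne_zero'] with e h h'
  have h1 : conjBack M (orbitMap hk (cayleyShift hk M e) : Mat n n) =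
      cayley (offDiag hk (blockOf e)) * E₀ n k * sympInv (cayley (offDiag hk (blockOf e))) := by
    change conjBack M ((cayleyShift hk M e : Mat n n) * E₀ n k *
      sympInv (cayleyShift hk M e : Mat n n)) = _
    have h0 := conjBack_conj M (cayley (offDiag hk (blockOf e)) * E₀ n k *
      sympInv (cayley (offDiag hk (blockOf e))))
    rw [coe_cayleyShift hk M h, sympInv_mul]
    simpa only [Matrix.mul_assoc] using h0
  obtain ⟨h2, h3⟩ := blocks_cayley_offDiag hk h h'
  obtain ⟨h4, h5⟩ := graphCoord_conj_of_blocks hk h2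
  constructor
  · change (sympInv (stdE n k) * conjBack M (orbitMap hk (cayleyShift hk M e) : Mat n n) *
      stdE n k).det ≠ 0
    rwa [h1]
  · change blockCoord (graphCoord hk (conjBack M
      (orbitMap hk (cayleyShift hk M e) : Mat n n))) = _
    rw [h1, h5, h3, blockCoord_smul, doubling]

theorem contDiffAt_doubling : ContDiffAt ℝ ∞ (doubling n k) 0 :=
  (((smoothMatAt_blockOf 0).mul ((smoothMatAt_one_sub 0).inv
    (by simp [blockOf_zero]))).blockCoord).const_smul (2 : ℝ)

theorem hasStrictFDerivAt_doubling : HasStrictFDerivAt (doubling n k)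
    ((2 : ℝ) • ContinuousLinearMap.id ℝ (EuclideanSpace ℝ (Fin (4 * (n - k) * k)))) 0 := by
  have h := (contDiffAt_doubling (n := n) (k := k)).hasStrictFDerivAt (by simp)
  suffices h0 : (2 : ℝ) • ContinuousLinearMap.id ℝ (EuclideanSpace ℝ (Fin (4 * (n - k) * k))) =
      fderiv ℝ (doubling n k) 0 by rwa [h0]
  ext1 e
  have h1 : HasDerivAt (fun t : ℝ => doubling n k (t • e)) (fderiv ℝ (doubling n k) 0 e) 0 := by
    have h2 : HasDerivAt (fun t : ℝ => t • e) e 0 := by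
      simpa using (hasDerivAt_id (0 : ℝ)).smul_const e
    refine HasFDerivAt.comp_hasDerivAt (l := doubling n k) (f := fun t : ℝ => t • e) (0 : ℝ) ?_ h2
    rw [zero_smul]
    exact h.hasFDerivAt
  -- Along a ray `doubling (t • e) = t • f t`, so the derivative at `0` is `f 0 = 2e` and the matrix
  -- inverse need not be differentiated explicitly.
  let f : ℝ → EuclideanSpace ℝ (Fin (4 * (n - k) * k)) := fun t => (2 : ℝ) • blockCoord
    (blockOf e * (1 - sympInv (blockOf (t • e)) * blockOf (t • e) : Mat k k)⁻¹)
  have hf : DifferentiableAt ℝ f 0 := by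
    have h3 : SmoothMatAt (fun t : ℝ => blockOf (n := n) (k := k) (t • e)) 0 := fun i j =>
      (smoothMatAt_blockOf _ i j).comp (0 : ℝ) (contDiffAt_id.smul contDiffAt_const)
    have h4 := ((SmoothMatAt.const (blockOf (n := n) (k := k) e)).mul
      (((SmoothMatAt.const 1).sub (h3.sympInv.mul h3)).inv
      (by simp [blockOf_zero]))).blockCoord.const_smul (2 : ℝ)
    exact h4.differentiableAt (by simp)
  have h5 : HasDerivAt (fun t : ℝ => t • f t) ((0 : ℝ) • deriv f 0 + (1 : ℝ) • f 0) 0 :=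
    (hasDerivAt_id (0 : ℝ)).smul hf.hasDerivAt
  have h6 : (fun t : ℝ => doubling n k (t • e)) = fun t => t • f t := by
    ext1 t
    simp only [doubling, f]
    rw [smul_comm t, ← blockCoord_smul t, blockOf_smul, Matrix.smul_mul]
  rw [h6] at h1
  have h7 := h1.unique h5
  rw [h7]
  simp [f, blockOf_zero]

theorem fderiv_doubling_surjective : Function.Surjective
    ((2 : ℝ) • ContinuousLinearMap.id ℝ (EuclideanSpace ℝ (Fin (4 * (n - k) * k)))) := fun e =>
  ⟨(2 : ℝ)⁻¹ • e, by simp⟩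

theorem cayleyShift_zero (hk : k ≤ n) (M : Sp n) : cayleyShift hk M 0 = M := by
  refine Subtype.ext ?_
  rw [coe_cayleyShift hk M (by simp [blockOf_zero, offDiag_zero])]
  simp [blockOf_zero, offDiag_zero, cayley]

theorem contDiffAt_cayleyShift (hk : k ≤ n) (M : Sp n) :
    ContDiffAt ℝ ∞ (fun e => spIncl n (cayleyShift hk M e)) 0 := by
  have h1 : SmoothMatAt (fun e => (M : Mat n n) * cayley (offDiag hk (blockOf e))) 0 :=
    (SmoothMatAt.const _).mul ((smoothMatAt_offDiag hk 0).cayley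
      (by simp [blockOf_zero, offDiag_zero]))
  refine h1.contDiffAt.congr_of_eventuallyEq ?_
  filter_upwards [eventually_det_ne_zero hk] with e he
  ext i j
  exact congrFun (congrFun (coe_cayleyShift hk M he) i) j

theorem contDiff_orbit :
    ContDiff ℝ ∞ (fun A : MatFun n => fun i j =>
      ((Matrix.of A : Mat n n) * E₀ n k * sympInv (Matrix.of A : Mat n n)) i j) :=
  contDiff_iff_contDiffAt.2 fun A => (((smoothMatAt_of A).mul (SmoothMatAt.const _)).mul
    (smoothMatAt_of A).sympInv).contDiffAt

theorem continuous_orbitMap (hk : k ≤ n) : Continuous (orbitMap hk) :=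
  (isEmbedding_grIncl n k).continuous_iff.2
    ((contDiff_orbit (k := k)).continuous.comp (isEmbedding_spIncl n).continuous)

/-- `doubling` maps neighbourhoods of `0` onto neighbourhoods, its strict derivative being
surjective. Hence every point near `orbitMap hk M` is reached along the slice through `M`. -/
theorem isOpenMap_orbitMap (hk : k ≤ n) : IsOpenMap (orbitMap hk) := by
  refine IsOpenMap.of_nhds_le fun M N hN => ?_
  have hs : ContinuousAt (cayleyShift hk M) 0 :=
    (isEmbedding_spIncl n).isInducing.continuousAt_iff.2 (contDiffAt_cayleyShift hk M).continuousAt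
  have hN' : {e | orbitMap hk (cayleyShift hk M e) ∈ N} ∈
      𝓝 (0 : EuclideanSpace ℝ (Fin (4 * (n - k) * k))) := by
    have h := hs.preimage_mem_nhds (t := orbitMap hk ⁻¹' N) (by rw [cayleyShift_zero]; exact hN)
    exact h
  have h0 : doubling n k 0 = grCoord hk M (grIncl n k (orbitMap hk M)) := by
    have h := (grCoord_orbitMap_cayleyShift hk M).self_of_nhds.2
    rw [cayleyShift_zero] at h
    exact h.symm
  have hmem : grIncl n k (orbitMap hk M) ∈ grSource k M := (grParam hk M rfl).mem_source
  have hG := hasStrictFDerivAt_doubling.map_nhds_eq_of_surj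
    (LinearMap.range_eq_top.2 (fderiv_doubling_surjective (n := n) (k := k)))
  have h1 : doubling n k '' ({e | orbitMap hk (cayleyShift hk M e) ∈ N} ∩
      {e | grIncl n k (orbitMap hk (cayleyShift hk M e)) ∈ grSource k M ∧
        grCoord hk M (grIncl n k (orbitMap hk (cayleyShift hk M e))) = doubling n k e}) ∈
      𝓝 (grCoord hk M (grIncl n k (orbitMap hk M))) := by
    rw [← h0, ← hG]
    exact image_mem_map (inter_mem hN' (grCoord_orbitMap_cayleyShift hk M))
  have h2 : ContinuousAt (fun P => grCoord hk M (grIncl n k P)) (orbitMap hk M) :=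
    (contDiffAt_grCoord hk M hmem).continuousAt.comp
      (isEmbedding_grIncl n k).continuous.continuousAt
  filter_upwards [h2.preimage_mem_nhds h1,
    ((isOpen_grSource M).preimage (isEmbedding_grIncl n k).continuous).mem_nhds hmem] with P hP hP'
  obtain ⟨e, ⟨he1, he2, he3⟩, he⟩ := hP
  -- Points of the Grassmannian in the chart domain are recovered from their coordinates, so equal
  -- coordinates force equal points.
  have h4 := (grParam hk M (P := orbitMap hk M) rfl).ψ_φ P hP'
  have h5 := (grParam hk M (P := orbitMap hk M) rfl).ψ_φ _ he2
  have h6 : grIncl n k P = grIncl n k (orbitMap hk (cayleyShift hk M e)) := by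
    rw [← h4, ← h5]
    change (grParam hk M rfl).ψ (grCoord hk M _) = (grParam hk M rfl).ψ (grCoord hk M _)
    rw [he3, he]
  rw [(isEmbedding_grIncl n k).injective h6]
  exact he1

theorem orbitMap_eq_iff (hk : k ≤ n) (M N : Sp n) :
    orbitMap hk M = orbitMap hk N ↔ M⁻¹ * N ∈ blockSubgroup hk := by
  rw [mem_blockSubgroup_iff, Subtype.ext_iff]
  change (M : Mat n n) * E₀ n k * sympInv (M : Mat n n) =
    (N : Mat n n) * E₀ n k * sympInv (N : Mat n n) ↔
    ((M⁻¹ : Sp n) : Mat n n) * (N : Mat n n) * E₀ n k *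
      sympInv (((M⁻¹ : Sp n) : Mat n n) * (N : Mat n n)) = E₀ n k
  have e : ((M⁻¹ : Sp n) : Mat n n) * (N : Mat n n) * E₀ n k *
      sympInv (((M⁻¹ : Sp n) : Mat n n) * (N : Mat n n)) =
      conjBack M ((N : Mat n n) * E₀ n k * sympInv (N : Mat n n)) := by
    rw [coe_inv_eq_sympInv, sympInv_mul, sympInv_sympInv]
    simp only [conjBack, Matrix.mul_assoc]
  rw [e]
  constructor
  · intro h
    rw [← h, conjBack_conj]
  · intro h
    have h' := conj_conjBack M ((N : Mat n n) * E₀ n k * sympInv (N : Mat n n))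
    rwa [h] at h'

/-- The coset space is homeomorphic to the Grassmannian. -/
noncomputable def cosetHomeomorph (hk : k ≤ n) : (Sp n ⧸ blockSubgroup hk) ≃ₜ SpGr n k :=
  (Equiv.ofBijective
    (Quotient.lift (orbitMap hk) fun M N h =>
      (orbitMap_eq_iff hk M N).2 (QuotientGroup.leftRel_apply.1 h))
    ⟨by
      rintro ⟨M⟩ ⟨N⟩ h
      exact QuotientGroup.eq.2 ((orbitMap_eq_iff hk M N).1 h), by
      intro P
      obtain ⟨M, hM⟩ := orbitMap_surjective hk P
      exact ⟨(M : Sp n ⧸ blockSubgroup hk), hM⟩⟩).toHomeomorphOfContinuousOpen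
    (continuous_quot_lift _ (continuous_orbitMap hk))
    (by
      intro U hU
      have h := isOpenMap_orbitMap hk _
        (hU.preimage (QuotientGroup.continuous_mk (N := blockSubgroup hk)))
      convert h using 1
      ext P
      constructor
      · rintro ⟨⟨M⟩, hM, rfl⟩
        exact ⟨M, hM, rfl⟩
      · rintro ⟨M, hM, rfl⟩
        exact ⟨_, hM, rfl⟩)

end Orbit

/-! ### The smooth structures -/

section Final

open Topology Filter

variable {n k : ℕ}

/-- The embedding of the coset space into `ℝ^{2n × 2n}`. -/
noncomputable def cosetIncl (hk : k ≤ n) (q : Sp n ⧸ blockSubgroup hk) : MatFun n :=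
  grIncl n k (cosetHomeomorph hk q)

theorem isEmbedding_cosetIncl (hk : k ≤ n) : IsEmbedding (cosetIncl hk) :=
  (isEmbedding_grIncl n k).comp (cosetHomeomorph hk).isEmbedding

/-- The parametrizations of the Grassmannian at all points. -/
noncomputable def grParamAt (hk : k ≤ n) (P : SpGr n k) :
    LocalParam (EuclideanSpace ℝ (Fin (4 * (n - k) * k))) (grIncl n k) P :=
  grParam hk (exists_smul_E₀_eq hk P.2).choose (exists_smul_E₀_eq hk P.2).choose_spec

/-- The parametrizations of the coset space at all points. -/
noncomputable def cosetParamAt (hk : k ≤ n) (q : Sp n ⧸ blockSubgroup hk) :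
    LocalParam (EuclideanSpace ℝ (Fin (4 * (n - k) * k))) (cosetIncl hk) q :=
  (grParamAt hk (cosetHomeomorph hk q)).congr
    ((cosetHomeomorph hk).surjective.range_comp (grIncl n k)) rfl

/-- The charts of the symplectic group. -/
@[reducible] noncomputable def spCharted (n : ℕ) :
    ChartedSpace (EuclideanSpace ℝ (Fin ((2 * n + 1) * n))) (Sp n) :=
  LocalParam.chartedSpace (isEmbedding_spIncl n) spParam

/-- The charts of the Grassmannian. -/
@[reducible] noncomputable def grCharted (hk : k ≤ n) :
    ChartedSpace (EuclideanSpace ℝ (Fin (4 * (n - k) * k))) (SpGr n k) :=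
  LocalParam.chartedSpace (isEmbedding_grIncl n k) (grParamAt hk)

/-- The charts of the coset space. -/
@[reducible] noncomputable def cosetCharted (hk : k ≤ n) :
    ChartedSpace (EuclideanSpace ℝ (Fin (4 * (n - k) * k))) (Sp n ⧸ blockSubgroup hk) :=
  LocalParam.chartedSpace (isEmbedding_cosetIncl hk) (cosetParamAt hk)

theorem isEmbeddedVia_of_localParam {d n : ℕ} {X : Type*} [TopologicalSpace X]
    {ι : X → MatFun n} (hι : IsEmbedding ι) (p : ∀ x, LocalParam (EuclideanSpace ℝ (Fin d)) ι x) :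
    letI := LocalParam.chartedSpace hι p
    IsEmbeddedVia d ι :=
  letI := LocalParam.chartedSpace hι p
  { isManifold := LocalParam.isManifold hι p
    isEmbedding := hι
    contMDiff := LocalParam.contMDiff_coe hι p
    immersion := LocalParam.mfderiv_injective hι p }

theorem contDiff_matMul : ContDiff ℝ ∞ (fun A : MatFun n × MatFun n => fun i j =>
    ((Matrix.of A.1 : Mat n n) * (Matrix.of A.2 : Mat n n)) i j) :=
  contDiff_iff_contDiffAt.2 fun _ =>
    ((ContDiffAt.smoothMatAt (f := fun A : MatFun n × MatFun n => A.1) contDiffAt_fst).mul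
      (ContDiffAt.smoothMatAt (f := fun A : MatFun n × MatFun n => A.2)
        contDiffAt_snd)).contDiffAt

theorem contDiff_sympInv : ContDiff ℝ ∞ (fun A : MatFun n => fun i j =>
    (sympInv (Matrix.of A : Mat n n)) i j) :=
  contDiff_iff_contDiffAt.2 fun A => (smoothMatAt_of A).sympInv.contDiffAt

theorem lieGroup_sp (n : ℕ) :
    letI := spCharted n
    LieGroup (𝓡 ((2 * n + 1) * n)) ∞ (Sp n) := by
  let := spCharted n
  have hM : IsManifold (𝓡 ((2 * n + 1) * n)) ∞ (Sp n) :=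
    LocalParam.isManifold (isEmbedding_spIncl n) spParam
  have hι : ContMDiff (𝓡 ((2 * n + 1) * n)) 𝓘(ℝ, MatFun n) ∞ (spIncl n) :=
    LocalParam.contMDiff_coe (isEmbedding_spIncl n) spParam
  refine { hM with contMDiff_mul := ?_, contMDiff_inv := ?_ }
  · refine LocalParam.contMDiff_of_comp (isEmbedding_spIncl n) spParam ?_
    exact contDiff_matMul.contMDiff.comp
      ((hι.comp contMDiff_fst).prodMk_space (hι.comp contMDiff_snd))
  · refine LocalParam.contMDiff_of_comp (isEmbedding_spIncl n) spParam ?_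
    have h := contDiff_sympInv.contMDiff.comp hι
    refine h.congr fun M => ?_
    ext i j
    exact congrFun (congrFun (coe_inv_eq_sympInv M) i) j

theorem contMDiff_mk (hk : k ≤ n) :
    letI := spCharted n
    letI := cosetCharted hk
    ContMDiff (𝓡 ((2 * n + 1) * n)) (𝓡 (4 * (n - k) * k)) ∞
      (fun M : Sp n => (M : Sp n ⧸ blockSubgroup hk)) := by
  let := spCharted n
  let := cosetCharted hk
  refine LocalParam.contMDiff_of_comp (isEmbedding_cosetIncl hk) (cosetParamAt hk) ?_
  exact (contDiff_orbit (k := k)).contMDiff.comp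
    (LocalParam.contMDiff_coe (isEmbedding_spIncl n) spParam)

/-- Differentiating coordinates ∘ quotient map ∘ slice gives `D ∘ Q ∘ S = 2 · id`. -/
theorem isSurjectiveSubmersion_mk (hk : k ≤ n) :
    letI := spCharted n
    letI := cosetCharted hk
    IsSurjectiveSubmersion ((2 * n + 1) * n) (4 * (n - k) * k)
      (fun M : Sp n => (M : Sp n ⧸ blockSubgroup hk)) := by
  let := spCharted n
  let := cosetCharted hk
  refine ⟨QuotientGroup.mk_surjective, contMDiff_mk hk, fun M => ?_⟩
  have hs : MDifferentiableAt (𝓡 (4 * (n - k) * k)) (𝓡 ((2 * n + 1) * n)) (cayleyShift hk M) 0 :=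
    (LocalParam.contMDiffAt_of_comp (isEmbedding_spIncl n) spParam
      (contDiffAt_cayleyShift hk M).contMDiffAt).mdifferentiableAt (by simp)
  have hq : MDifferentiableAt (𝓡 ((2 * n + 1) * n)) (𝓡 (4 * (n - k) * k))
      (fun M : Sp n => (M : Sp n ⧸ blockSubgroup hk)) (cayleyShift hk M 0) :=
    (contMDiff_mk hk _).mdifferentiableAt (by simp)
  have hmem : cosetIncl hk (M : Sp n ⧸ blockSubgroup hk) ∈ grSource k M :=
    (grParam hk M (P := orbitMap hk M) rfl).mem_source
  have hφ : MDifferentiableAt (𝓡 (4 * (n - k) * k)) (𝓡 (4 * (n - k) * k))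
      (fun q => grCoord hk M (cosetIncl hk q))
      ((cayleyShift hk M 0 : Sp n) : Sp n ⧸ blockSubgroup hk) := by
    rw [cayleyShift_zero]
    exact ((contDiffAt_grCoord hk M hmem).contMDiffAt.comp _
      (LocalParam.contMDiff_coe (isEmbedding_cosetIncl hk) (cosetParamAt hk) _)).mdifferentiableAt
      (by simp)
  have h1 := (hφ.hasMFDerivAt.comp _ hq.hasMFDerivAt).comp _ hs.hasMFDerivAt
  have h2 : HasMFDerivAt (𝓡 (4 * (n - k) * k)) (𝓡 (4 * (n - k) * k))
      (((fun q => grCoord hk M (cosetIncl hk q)) ∘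
        fun M : Sp n => (M : Sp n ⧸ blockSubgroup hk)) ∘ cayleyShift hk M) 0
      ((2 : ℝ) • ContinuousLinearMap.id ℝ (EuclideanSpace ℝ (Fin (4 * (n - k) * k)))) := by
    refine (hasStrictFDerivAt_doubling.hasFDerivAt.congr_of_eventuallyEq ?_).hasMFDerivAt
    filter_upwards [grCoord_orbitMap_cayleyShift hk M] with e he
    exact he.2
  have h3 := hasMFDerivAt_unique h1 h2
  have key : ∀ {a b : ℕ} {S : EuclideanSpace ℝ (Fin a) →L[ℝ] EuclideanSpace ℝ (Fin b)}
      {Q : EuclideanSpace ℝ (Fin b) →L[ℝ] EuclideanSpace ℝ (Fin a)}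
      {D : EuclideanSpace ℝ (Fin a) →L[ℝ] EuclideanSpace ℝ (Fin a)},
      (D.comp Q).comp S = (2 : ℝ) • ContinuousLinearMap.id ℝ _ → Function.Surjective Q := by
    intro a b S Q D h
    -- `grCoord hk M` need not be the chart selected at this point, so invertibility of `D` is read
    -- off from the identity: `D` is surjective between spaces of equal dimension, hence injective.
    have hD : Function.Surjective D := fun y => ⟨Q (S ((2 : ℝ)⁻¹ • y)), by
      have := DFunLike.congr_fun h ((2 : ℝ)⁻¹ • y)
      simpa using this⟩
    have hD' : Function.Injective D.toLinearMap := LinearMap.injective_iff_surjective.2 hD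
    intro y
    refine ⟨S ((2 : ℝ)⁻¹ • D y), hD' ?_⟩
    have := DFunLike.congr_fun h ((2 : ℝ)⁻¹ • D y)
    simpa using this
  have h4 := key h3
  rwa [cayleyShift_zero] at h4

/-- The diffeomorphism from the coset space to the Grassmannian. -/
noncomputable def cosetDiffeomorph (hk : k ≤ n) :
    letI := grCharted hk
    letI := cosetCharted hk
    Diffeomorph (𝓡 (4 * (n - k) * k)) (𝓡 (4 * (n - k) * k))
      (Sp n ⧸ blockSubgroup hk) (SpGr n k) ∞ :=
  letI := grCharted hk
  letI := cosetCharted hk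
  { toEquiv := (cosetHomeomorph hk).toEquiv
    -- `cosetIncl` is `grIncl` after the bijection, so in the ambient space each direction becomes
    -- an inclusion already known to be smooth.
    contMDiff_toFun :=
      LocalParam.contMDiff_of_comp (isEmbedding_grIncl n k) (grParamAt hk)
        (LocalParam.contMDiff_coe (isEmbedding_cosetIncl hk) (cosetParamAt hk))
    contMDiff_invFun := by
      refine LocalParam.contMDiff_of_comp (isEmbedding_cosetIncl hk) (cosetParamAt hk) ?_
      refine (LocalParam.contMDiff_coe (isEmbedding_grIncl n k) (grParamAt hk)).congr fun P => ?_
      exact congrArg (grIncl n k) ((cosetHomeomorph hk).apply_symm_apply P) }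

end Final

end SpGrassmann

open SpGrassmann
theorem mainTheorem4 (n k : ℕ) (hk : k ≤ n) :
    -- the elements of `SpGr` are exactly the symplectic projections onto the symplectic
    -- subspaces of dimension `2k`, and each such subspace has exactly one of them
    (SpGr n k = {P | ∃ W, IsSymplecticSubspace W ∧ Module.finrank ℝ W = 2 * k ∧
      IsSymplecticProjection W P}) ∧
    (∀ W : Submodule ℝ (Fin n ⊕ Fin n → ℝ), IsSymplecticSubspace W →
      Module.finrank ℝ W = 2 * k → ∃! P, IsSymplecticProjection W P) ∧
    (∀ P ∈ SpGr n k, ∃ U ∈ SpSt n k, P = U * sympInv U) ∧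
    -- `Sp(2n)` with its structure of a matrix Lie group, `SpGr` (with the subspace topology) and
    -- the coset space (with the quotient topology) with their smooth manifold structures
    ∃ (_ : ChartedSpace (EuclideanSpace ℝ (Fin ((2 * n + 1) * n))) (Sp n))
      (_ : ChartedSpace (EuclideanSpace ℝ (Fin (4 * (n - k) * k))) (SpGr n k))
      (_ : ChartedSpace (EuclideanSpace ℝ (Fin (4 * (n - k) * k))) (Sp n ⧸ blockSubgroup hk)),
      LieGroup (𝓡 ((2 * n + 1) * n)) ∞ (Sp n) ∧
      IsEmbeddedVia ((2 * n + 1) * n) (fun (M : Sp n) i j => (M : Mat n n) i j) ∧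
      IsEmbeddedVia (4 * (n - k) * k) (fun (P : SpGr n k) i j => (P : Mat n n) i j) ∧
      IsManifold (𝓡 (4 * (n - k) * k)) ∞ (Sp n ⧸ blockSubgroup hk) ∧
      IsSurjectiveSubmersion ((2 * n + 1) * n) (4 * (n - k) * k)
        (fun M : Sp n => (M : Sp n ⧸ blockSubgroup hk)) ∧
      ∃ Φ : Diffeomorph (𝓡 (4 * (n - k) * k)) (𝓡 (4 * (n - k) * k))
          (Sp n ⧸ blockSubgroup hk) (SpGr n k) ∞,
        ∀ M : Sp n, (Φ (M : Sp n ⧸ blockSubgroup hk) : Mat n n) =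
          (M : Mat n n) * E₀ n k * sympInv (M : Mat n n) :=
  ⟨SpGr_eq n k, fun _ hW hd => existsUnique_isSymplecticProjection hW hd,
    fun _ hP => exists_eq_mul_sympInv hP, spCharted n, grCharted hk, cosetCharted hk,
    lieGroup_sp n, isEmbeddedVia_of_localParam (isEmbedding_spIncl n) spParam,
    isEmbeddedVia_of_localParam (isEmbedding_grIncl n k) (grParamAt hk),
    LocalParam.isManifold (isEmbedding_cosetIncl hk) (cosetParamAt hk),
    isSurjectiveSubmersion_mk hk, cosetDiffeomorph hk, fun _ => rfl⟩
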